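/- For a finite-dimensional complex Hilbert space $X$, equip its unitary group $\mathrm{Aut}(X)$ with the metric $d(A,B)=\|A-B\|_{HS}$, where $\|A\|_{HS}=\mathrm{Tr}(A^*A)^{1/2}$ and $\mathrm{Tr}$ is the normalized trace; let $\mathcal{C}_{HS}$ be the class of these metric groups. For a finite set $X$, equip its symmetric group $\mathrm{Aut}(X)$ with the normalized Hamming distance $d(\sigma,\tau)=\frac{1}{|X|}\#\{x\in X:\sigma(x)\neq\tau(x)\}$; let $\mathcal{C}_P$ be the class of these metric groups. (If $X=0$, respectively $X=\emptyset$, the group is trivial and $d=0$.) For $\mathcal{C}\in\{\mathcal{C}_{HS},\mathcal{C}_P\}$, a group $G$ is called $\mathcal{C}$-stable if for any sequence of maps $\varphi_n\colon G\to\mathrm{Aut}(X_n)\in\mathcal{C}$ such that $d(\varphi_n(a)\varphi_n(b),\varphi_n(ab))\to 0$ as $n\to\infty$ for all $a,b\in G$, there exists a sequence of homomorphisms $\psi_n\colon G\to\mathrm{Aut}(X_n)$ such that $d(\varphi_n(a),\psi_n(a))\to 0$ as $n\to\infty$ for all $a\in G$. **Theorem.** Let $\mathcal{C}=\mathcal{C}_{HS}$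 or $\mathcal{C}=\mathcal{C}_P$. Let $G_1,G_2$ be finitely generated $\mathcal{C}$-stable groups, let $H$ be a finite group, and let $i_1\colon H\to G_1$ and $i_2\colon H\to G_2$ be injective homomorphisms such that $i_1(H)$ is normal in $G_1$ and $i_2(H)$ is normal in $G_2$. Then the amalgamated free product $$G_1*_HG_2=(G_1*G_2)/\langle\langle\, i_1(h)i_2(h)^{-1} : h\in H\,\rangle\rangle$$ is $\mathcal{C}$-stable. -/

import Mathlib

open Filter Topology

noncomputable section

/-- Stability of a group `G` with respect to a class of groups `C i` equipped with metrics
`d i`: every sequence of maps from `G` into members of the class that is asymptotically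
multiplicative is pointwise asymptotically close to a sequence of homomorphisms. -/
def IsStableWrt {ι : Type*} (C : ι → Type*) [∀ i, Group (C i)]
    (d : ∀ i, C i → C i → ℝ) (G : Type*) [Group G] : Prop :=
  ∀ (X : ℕ → ι) (φ : ∀ n, G → C (X n)),
    (∀ a b : G,
      Tendsto (fun n => d (X n) (φ n a * φ n b) (φ n (a * b))) atTop (𝓝 0)) →
    ∃ ψ : ∀ n, G →* C (X n),
      ∀ a : G, Tendsto (fun n => d (X n) (φ n a) (ψ n a)) atTop (𝓝 0)

/-- A finite-dimensional complex Hilbert space. -/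
structure FdHilb : Type 1 where
  carrier : Type
  [normed : NormedAddCommGroup carrier]
  [inner : InnerProductSpace ℂ carrier]
  [finiteDimensional : FiniteDimensional ℂ carrier]

attribute [instance] FdHilb.normed FdHilb.inner FdHilb.finiteDimensional

/-- The unitary group of a finite-dimensional Hilbert space. -/
abbrev FdHilb.Aut (X : FdHilb) : Type := X.carrier ≃ₗᵢ[ℂ] X.carrier

/-- The Hilbert-Schmidt norm `(Tr (A* A)) ^ (1/2)`, where `Tr` is the normalized trace. -/
def hsNorm {X : Type*} [NormedAddCommGroup X] [InnerProductSpace ℂ X] [FiniteDimensional ℂ X]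
    (A : X →ₗ[ℂ] X) : ℝ :=
  Real.sqrt ((LinearMap.trace ℂ X (LinearMap.adjoint A ∘ₗ A)).re / Module.finrank ℂ X)

/-- The metric `‖A - B‖_HS` on the unitary group. -/
def hsDist (X : FdHilb) (A B : X.Aut) : ℝ :=
  hsNorm (A.toLinearEquiv.toLinearMap - B.toLinearEquiv.toLinearMap)

/-- A finite set. -/
structure FinSet : Type 1 where
  carrier : Type
  [finite : Finite carrier]

attribute [instance] FinSet.finite

/-- The symmetric group of a finite set. -/
abbrev FinSet.Aut (X : FinSet) : Type := Equiv.Perm X.carrier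

/-- The normalized Hamming distance on the symmetric group. -/
def hammDist (X : FinSet) (σ τ : X.Aut) : ℝ :=
  (Nat.card {x : X.carrier // σ x ≠ τ x} : ℝ) / Nat.card X.carrier

/-- Hilbert-Schmidt stability. -/
def IsHSStable (G : Type*) [Group G] : Prop := IsStableWrt FdHilb.Aut hsDist G

/-- Stability in permutations. -/
def IsPStable (G : Type*) [Group G] : Prop := IsStableWrt FinSet.Aut hammDist G

/-- The amalgamated free product `G₁ *_H G₂`: the quotient of the free product `G₁ * G₂` by
the normal closure of the elements `i₁ h * (i₂ h)⁻¹`. -/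
abbrev AmalgamatedProduct {H G₁ G₂ : Type*} [Group H] [Group G₁] [Group G₂]
    (i₁ : H →* G₁) (i₂ : H →* G₂) : Type _ :=
  Monoid.Coprod G₁ G₂ ⧸ Subgroup.normalClosure
    (Set.range fun h : H =>
      (Monoid.Coprod.inl (i₁ h) * (Monoid.Coprod.inr (i₂ h))⁻¹ : Monoid.Coprod G₁ G₂))

end

noncomputable section

/-- A sequence of reals that is negligible with respect to a sequence of sizes. -/
def Negl (N : ℕ → ℕ) (u : ℕ → ℝ) : Prop := Tendsto (fun n => u n / N n) atTop (𝓝 0)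

namespace Negl

variable {N : ℕ → ℕ} {u v : ℕ → ℝ}

theorem zero (N : ℕ → ℕ) : Negl N fun _ => 0 := by simp [Negl]

theorem add (hu : Negl N u) (hv : Negl N v) : Negl N fun n => u n + v n := by
  simpa [Negl, add_div] using Tendsto.add hu hv

theorem const_mul (c : ℝ) (hu : Negl N u) : Negl N fun n => c * u n := by
  simpa [Negl, mul_div_assoc] using Tendsto.const_mul c hu

theorem sum {α : Type*} (s : Finset α) {w : α → ℕ → ℝ} (hw : ∀ a ∈ s, Negl N (w a)) :
    Negl N fun n => ∑ a ∈ s, w a n := by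
  simpa [Negl, Finset.sum_div] using tendsto_finsetSum s hw

theorem of_le (hv : Negl N v) (h0 : ∀ n, 0 ≤ u n) (h : ∀ n, u n ≤ v n) : Negl N u :=
  squeeze_zero (fun n => div_nonneg (h0 n) (Nat.cast_nonneg _))
    (fun n => div_le_div_of_nonneg_right (h n) (Nat.cast_nonneg _)) hv

theorem of_abs_le (hv : Negl N v) (h : ∀ n, |u n| ≤ v n) : Negl N u := by
  refine squeeze_zero_norm (fun n => ?_) hv
  rw [Real.norm_eq_abs, abs_div, Nat.abs_cast]
  exact div_le_div_of_nonneg_right (h n) (Nat.cast_nonneg _)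

theorem abs (hu : Negl N u) : Negl N fun n => |u n| := by
  have := Tendsto.abs hu
  simpa [Negl, abs_div] using this

/-- Passing to larger sizes keeps a sequence negligible, if it vanishes where the sizes do. -/
theorem mono_size {N' : ℕ → ℕ} (hu : Negl N' u) (h0 : ∀ n, 0 ≤ u n)
    (hN : ∀ n, N' n ≤ N n) (hz : ∀ n, N' n = 0 → u n = 0) : Negl N u := by
  refine squeeze_zero (fun n => div_nonneg (h0 n) (Nat.cast_nonneg _)) (fun n => ?_) hu
  rcases Nat.eq_zero_or_pos (N' n) with h | h
  · simp [hz n h]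
  · exact div_le_div_of_nonneg_left (h0 n) (by exact_mod_cast h) (by exact_mod_cast hN n)

end Negl

/-- In a submonoid of `ℕ` containing `L`, the difference of a multiple of `L` and a sufficiently
smaller member is a member. -/
theorem AddSubmonoid.exists_forall_sub_mem (S : AddSubmonoid ℕ) {L : ℕ} (hL : 0 < L)
    (hLS : L ∈ S) : ∃ M : ℕ, ∀ s ∈ S, ∀ t, L ∣ t → s + M ≤ t → t - s ∈ S := by
  classical
  have hw : ∀ r : ℕ, ∃ w ∈ S, (∃ s ∈ S, s % L = r) → w % L = r := by
    intro r
    by_cases h : ∃ s ∈ S, s % L = r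
    · obtain ⟨s, hs, hr⟩ := h
      exact ⟨s, hs, fun _ => hr⟩
    · exact ⟨0, S.zero_mem, fun h' => absurd h' h⟩
  choose w hwS hwr using hw
  refine ⟨∑ r ∈ Finset.range L, (L - 1) * w r, fun s hs t ht hst => ?_⟩
  have hle : (L - 1) * w (s % L) ≤ ∑ r ∈ Finset.range L, (L - 1) * w r :=
    Finset.single_le_sum (f := fun r => (L - 1) * w r) (fun _ _ => Nat.zero_le _)
      (Finset.mem_range.2 (Nat.mod_lt _ hL))
  have hmod : w (s % L) % L = s % L := hwr _ ⟨s, hs, rfl⟩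
  set v := w (s % L) with hv
  obtain ⟨d, hd⟩ : L ∣ t - s - (L - 1) * v := by
    have h1 : (L : ℤ) ∣ (v : ℤ) - s := by
      have : (s : ℤ) ≡ v [ZMOD L] := by
        rw [Int.natCast_modEq_iff]; exact hmod.symm
      exact this.dvd
    have h2 : (L : ℤ) ∣ (t : ℤ) := by exact_mod_cast ht
    have h3 : ((t - s - (L - 1) * v : ℕ) : ℤ) = t + (v - s) - L * v := by
      rw [Nat.cast_sub (by omega), Nat.cast_sub (by omega), Nat.cast_mul,
        Nat.cast_sub (by omega)]
      push_cast; ring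
    have h4 : (L : ℤ) ∣ ((t - s - (L - 1) * v : ℕ) : ℤ) := by
      rw [h3]; exact (h2.add h1).sub (Dvd.intro _ rfl)
    exact_mod_cast h4
  have : t - s = (L - 1) • v + d • L := by
    simp only [smul_eq_mul]
    rw [mul_comm d L, ← hd]; omega
  rw [this]
  exact S.add_mem (S.nsmul_mem (hwS _) _) (S.nsmul_mem hLS _)

/-- The data for measuring representations of a group `H` in the members of a class of groups:
sizes, an unnormalized squared distance, and multiplicities of types. -/
structure MultiplicitySystem {ι : Type*} (C : ι → Type*) [∀ i, Group (C i)]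
    (H : Type*) [Group H] (T : Type*) where
  size : ι → ℕ
  gap : ∀ {X : ι}, C X → C X → ℝ
  mult : ∀ {X : ι}, (H →* C X) → T → ℕ

/-- The homomorphism `J` presents `X` as the sum of `A` and `B`. -/
structure MultiplicitySystem.IsSplitting {ι : Type*} {C : ι → Type*} [∀ i, Group (C i)]
    {H : Type*} [Group H] {T : Type*} (S : MultiplicitySystem C H T) {X A B : ι}
    (J : C A × C B →* C X) : Prop where
  injective : Function.Injective J
  size_eq : S.size X = S.size A + S.size B
  gap_eq : ∀ a a' b b', S.gap (J (a, b)) (J (a', b')) = S.gap a a' + S.gap b b'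
  mult_eq : ∀ (ρ : H →* C A) (ρ' : H →* C B) (τ : T),
    S.mult (J.comp (ρ.prod ρ')) τ = S.mult ρ τ + S.mult ρ' τ
  near : ∀ x, ∃ a, S.gap x (J (a, 1)) ≤ 8 * S.size B

/-- A multiplicity system in which representations of `H` can be compared, cut and replaced. -/
structure SurgerySystem {ι : Type*} (C : ι → Type*) [∀ i, Group (C i)]
    (H : Type*) [Group H] [Fintype H] (T : Type*) [Fintype T] [MulAction (MulAut H) T]
    extends MultiplicitySystem C H T where
  gap_nonneg : ∀ {X : ι} (a b : C X), 0 ≤ gap a b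
  gap_self : ∀ {X : ι} (a : C X), gap a a = 0
  gap_comm : ∀ {X : ι} (a b : C X), gap a b = gap b a
  gap_triangle : ∀ {X : ι} (a b c : C X), gap a c ≤ 2 * (gap a b + gap b c)
  gap_mul_left : ∀ {X : ι} (c a b : C X), gap (c * a) (c * b) = gap a b
  gap_mul_right : ∀ {X : ι} (c a b : C X), gap (a * c) (b * c) = gap a b
  gap_le : ∀ {X : ι} (a b : C X), gap a b ≤ 4 * size X
  sum_mult : ∀ {X : ι} (ρ : H →* C X), ∑ τ, mult ρ τ = size X
  mult_comp : ∀ {X : ι} (ρ : H →* C X) (α : MulAut H) (τ : T),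
    mult (ρ.comp α.toMonoidHom) τ = mult ρ (α • τ)
  mult_conj : ∀ {X : ι} (ρ : H →* C X) (u : C X) (τ : T),
    mult ((MulAut.conj u).toMonoidHom.comp ρ) τ = mult ρ τ
  mult_sub_le : ∀ {X : ι} (ρ ρ' : H →* C X) (τ : T),
    (mult ρ τ : ℝ) - mult ρ' τ ≤ ∑ h, gap (ρ h) (ρ' h)
  triv : T
  smul_triv : ∀ α : MulAut H, α • triv = triv
  mult_one : ∀ {X : ι} (τ : T), τ ≠ triv → mult (1 : H →* C X) τ = 0
  exists_splitting_size : ∀ (X : ι) (k : ℕ), k ≤ size X →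
    ∃ (A B : ι) (J : C A × C B →* C X), toMultiplicitySystem.IsSplitting J ∧ size A = k
  exists_splitting_mult : ∀ {X : ι} (ρ : H →* C X) (O : Set T),
    ∃ (A B : ι) (J : C A × C B →* C X), toMultiplicitySystem.IsSplitting J ∧
      (∀ (α : MulAut H) (a : C X), (∀ h, ρ (α h) = a * ρ h * a⁻¹) →
        (∀ τ, α • τ ∈ O ↔ τ ∈ O) → a ∈ J.range) ∧
      ∀ (ρA : H →* C A) (ρB : H →* C B), J.comp (ρA.prod ρB) = ρ →
        (∀ τ ∉ O, mult ρA τ = 0) ∧ ∀ τ ∈ O, mult ρB τ = 0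
  exists_transport : ∀ {X Y : ι}, size X = size Y →
    ∃ e : C X →* C Y, ∀ (ρ : H →* C X) (τ : T), mult (e.comp ρ) τ = mult ρ τ
  exists_conj : ∀ {X : ι} (ρ ρ' : H →* C X), (∀ τ, mult ρ τ = mult ρ' τ) →
    ∃ u : C X, (∀ h, u * ρ h * u⁻¹ = ρ' h) ∧ gap u 1 ≤ 4 * ∑ h, gap (ρ h) (ρ' h)

namespace SurgerySystem

section TypeOrbit

variable {H : Type*} [Group H] {T : Type*} [MulAction (MulAut H) T] {G : Type*} [Group G]

/-- The orbit of a type under a group acting on `H` by automorphisms. -/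
def typeOrbit (θ : G →* MulAut H) (σ : T) : Set T := Set.range fun g => θ g • σ

theorem smul_mem_typeOrbit (θ : G →* MulAut H) (σ : T) (g : G) (τ : T) :
    θ g • τ ∈ typeOrbit θ σ ↔ τ ∈ typeOrbit θ σ := by
  constructor
  · rintro ⟨k, hk⟩
    refine ⟨g⁻¹ * k, ?_⟩
    simp only [map_mul, mul_smul, map_inv] at hk ⊢
    rw [hk, inv_smul_smul]
  · rintro ⟨k, rfl⟩
    exact ⟨g * k, by simp [mul_smul]⟩

theorem mem_typeOrbit_self (θ : G →* MulAut H) (σ : T) : σ ∈ typeOrbit θ σ := ⟨1, by simp⟩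

end TypeOrbit

variable {ι : Type*} {C : ι → Type*} [∀ i, Group (C i)] {H : Type*} [Group H] [Fintype H]
  {T : Type*} [Fintype T] [MulAction (MulAut H) T] (S : SurgerySystem C H T)

/-- The distance obtained from the gap by normalization. -/
def dist (X : ι) (a b : C X) : ℝ := S.gap a b / S.size X

theorem gap_mul_mul_le {X : ι} (a a' b b' : C X) :
    S.gap (a * b) (a' * b') ≤ 2 * (S.gap a a' + S.gap b b') := by
  have := S.gap_triangle (a * b) (a' * b) (a' * b')
  rwa [S.gap_mul_right, S.gap_mul_left] at this

theorem gap_eq_zero_of_size {X : ι} (h : S.size X = 0) (a b : C X) : S.gap a b = 0 :=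
  le_antisymm (by simpa [h] using S.gap_le a b) (S.gap_nonneg a b)

theorem abs_mult_sub_le {X : ι} (ρ ρ' : H →* C X) (τ : T) :
    |(S.mult ρ τ : ℝ) - S.mult ρ' τ| ≤ ∑ h, S.gap (ρ h) (ρ' h) := by
  refine abs_le.2 ⟨?_, S.mult_sub_le ρ ρ' τ⟩
  have := S.mult_sub_le ρ' ρ τ
  simp only [S.gap_comm (ρ' _)] at this
  linarith

variable {G : Type*} [Group G] (i : H →* G) (θ : G →* MulAut H)

theorem triv_notMem_typeOrbit {σ : T} (hσ : σ ≠ S.triv) : S.triv ∉ typeOrbit θ σ := by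
  rintro ⟨g, hg⟩
  have : σ = (θ g)⁻¹ • S.triv := by rw [← hg]; simp
  exact hσ (this.trans (S.smul_triv _))

variable {i θ}

theorem mult_smul (hθ : ∀ g h, i (θ g h) = g * i h * g⁻¹) {X : ι} (ψ : G →* C X) (g : G) (τ : T) :
    S.mult (ψ.comp i) (θ g • τ) = S.mult (ψ.comp i) τ := by
  rw [← S.mult_comp, ← S.mult_conj (ψ.comp i) (ψ g)]
  congr 1
  ext h
  simp [hθ]

theorem mult_eq_of_mem (hθ : ∀ g h, i (θ g h) = g * i h * g⁻¹) {X : ι} (ψ : G →* C X) {σ τ : T}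
    (hτ : τ ∈ typeOrbit θ σ) : S.mult (ψ.comp i) τ = S.mult (ψ.comp i) σ := by
  obtain ⟨g, rfl⟩ := hτ
  exact S.mult_smul hθ ψ g σ

theorem exists_splitting_of_invariant (hθ : ∀ g h, i (θ g h) = g * i h * g⁻¹) {X : ι}
    (ψ : G →* C X) (O : Set T) (hO : ∀ g τ, θ g • τ ∈ O ↔ τ ∈ O) :
    ∃ (A B : ι) (J : C A × C B →* C X) (α : G →* C A) (β : G →* C B), S.IsSplitting J ∧
      J.comp (α.prod β) = ψ ∧ (∀ τ ∉ O, S.mult (α.comp i) τ = 0) ∧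
      ∀ τ ∈ O, S.mult (β.comp i) τ = 0 := by
  obtain ⟨A, B, J, hJ, hrange, hpure⟩ := S.exists_splitting_mult (ψ.comp i) O
  have hmem : ∀ g, ψ g ∈ J.range := fun g =>
    hrange (θ g) (ψ g) (fun h => by simp [hθ]) (hO g)
  let F : G →* C A × C B :=
    (MonoidHom.ofInjective hJ.injective).symm.toMonoidHom.comp (ψ.codRestrict J.range hmem)
  have hF : J.comp F = ψ := by
    ext g
    have := MonoidHom.apply_ofInjective_symm hJ.injective ⟨ψ g, hmem g⟩
    exact this
  refine ⟨A, B, J, (MonoidHom.fst _ _).comp F, (MonoidHom.snd _ _).comp F, hJ, ?_, ?_⟩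
  · rw [← hF]; rfl
  · apply hpure
    rw [← hF]; rfl

/-- The multiplicities `k` such that every large enough member carries a representation of `G`
in which the types in `O` have multiplicity `k` and all other nontrivial types are absent. -/
def fillers (i : H →* G) (O : Set T) : AddSubmonoid ℕ where
  carrier := {k | ∀ Z, k * O.ncard ≤ S.size Z → ∃ ψ : G →* C Z, ∀ τ ≠ S.triv,
    S.mult (ψ.comp i) τ = O.indicator (fun _ => k) τ}
  zero_mem' Z _ := ⟨1, fun τ hτ => by
    rw [MonoidHom.one_comp, S.mult_one τ hτ]; simp⟩
  add_mem' {k k'} hk hk' Z hZ := by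
    obtain ⟨A, B, J, hJ, hA⟩ := S.exists_splitting_size Z (k * O.ncard) (by nlinarith)
    obtain ⟨α, hα⟩ := hk A hA.ge
    obtain ⟨β, hβ⟩ := hk' B (by have := hJ.size_eq; nlinarith)
    refine ⟨J.comp (α.prod β), fun τ hτ => ?_⟩
    have := hJ.mult_eq (α.comp i) (β.comp i) τ
    rw [hα τ hτ, hβ τ hτ] at this
    refine Eq.trans this ?_
    by_cases hτO : τ ∈ O <;> simp [hτO]

theorem size_eq_of_mult_eq_indicator {X : ι} (ρ : H →* C X) {O : Set T} {k : ℕ}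
    (h : ∀ τ, S.mult ρ τ = O.indicator (fun _ => k) τ) : S.size X = k * O.ncard := by
  classical
  rw [← S.sum_mult ρ, Finset.sum_congr rfl fun τ _ => h τ]
  simp [Set.indicator_apply, Set.ncard_eq_toFinset_card', Finset.sum_ite, mul_comm]

theorem mul_ncard_le_size {X : ι} (ρ : H →* C X) {O : Set T} {k : ℕ}
    (h : ∀ τ ∈ O, S.mult ρ τ = k) : k * O.ncard ≤ S.size X := by
  classical
  rw [← S.sum_mult ρ]
  calc k * O.ncard = ∑ τ, O.indicator (fun _ => k) τ := by
        simp [Set.indicator_apply, Set.ncard_eq_toFinset_card', Finset.sum_ite, mul_comm]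
    _ ≤ _ := Finset.sum_le_sum fun τ _ => by
        by_cases hτ : τ ∈ O <;> simp [hτ, h]

theorem mem_fillers (hθ : ∀ g h, i (θ g h) = g * i h * g⁻¹) {σ : T} {X : ι}
    (ψ : G →* C X) : S.mult (ψ.comp i) σ ∈ S.fillers i (typeOrbit θ σ) := by
  intro Z hZ
  obtain ⟨P, W, J, π, ω, hJ, rfl, hπ, hω⟩ :=
    S.exists_splitting_of_invariant hθ ψ _ (smul_mem_typeOrbit θ σ)
  set O := typeOrbit θ σ
  set k := S.mult ((J.comp (π.prod ω)).comp i) σ with hk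
  have hπO : ∀ τ, S.mult (π.comp i) τ = O.indicator (fun _ => k) τ := fun τ => by
    by_cases hτ : τ ∈ O
    · rw [Set.indicator_of_mem hτ, hk, ← S.mult_eq_of_mem hθ _ hτ]
      have := hJ.mult_eq (π.comp i) (ω.comp i) τ
      rw [hω τ hτ, add_zero] at this
      exact this.symm
    · rw [Set.indicator_of_notMem hτ, hπ τ hτ]
  obtain ⟨A, B, J', hJ', hA⟩ := S.exists_splitting_size Z _ hZ
  obtain ⟨e, he⟩ := S.exists_transport (X := P) (Y := A)
    (by rw [hA, S.size_eq_of_mult_eq_indicator _ hπO])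
  refine ⟨J'.comp ((e.comp π).prod 1), fun τ hτ => ?_⟩
  have := hJ'.mult_eq (e.comp (π.comp i)) 1 τ
  rw [S.mult_one τ hτ, he, hπO, add_zero] at this
  rw [← this]; rfl

/-- The multiplicity of the types in an orbit can be raised by a filler, at the expense of the
representation outside the orbit. -/
theorem exists_raise (hθ : ∀ g h, i (θ g h) = g * i h * g⁻¹) {σ : T} {X : ι} (ξ : G →* C X)
    {t : ℕ} (ht : S.mult (ξ.comp i) σ ≤ t) (hX : t * (typeOrbit θ σ).ncard ≤ S.size X)
    (hfill : t - S.mult (ξ.comp i) σ ∈ S.fillers i (typeOrbit θ σ)) :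
    ∃ ζ : G →* C X, (∀ τ ≠ S.triv,
        S.mult (ζ.comp i) τ = (typeOrbit θ σ).indicator (fun _ => t) τ) ∧
      ∀ g, S.gap (ξ g) (ζ g) ≤
        4 * ((S.size X : ℝ) - S.mult (ξ.comp i) σ * (typeOrbit θ σ).ncard) := by
  obtain ⟨P, W, J, π, ω, hJ, rfl, hπ, hω⟩ :=
    S.exists_splitting_of_invariant hθ ξ _ (smul_mem_typeOrbit θ σ)
  set O := typeOrbit θ σ
  set k := S.mult ((J.comp (π.prod ω)).comp i) σ with hk
  have hπO : ∀ τ, S.mult (π.comp i) τ = O.indicator (fun _ => k) τ := fun τ => by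
    by_cases hτ : τ ∈ O
    · rw [Set.indicator_of_mem hτ, hk, ← S.mult_eq_of_mem hθ _ hτ]
      have := hJ.mult_eq (π.comp i) (ω.comp i) τ
      rw [hω τ hτ, add_zero] at this
      exact this.symm
    · rw [Set.indicator_of_notMem hτ, hπ τ hτ]
  have hP := S.size_eq_of_mult_eq_indicator _ hπO
  have hsize := hJ.size_eq
  obtain ⟨ω', hω'⟩ := hfill W (by rw [Nat.sub_mul]; omega)
  refine ⟨J.comp (π.prod ω'), fun τ hτ => ?_, fun g => ?_⟩
  · have := hJ.mult_eq (π.comp i) (ω'.comp i) τ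
    rw [hω' τ hτ, hπO] at this
    refine Eq.trans this ?_
    by_cases hτO : τ ∈ O <;> simp [hτO, ht]
  · have h1 := hJ.gap_eq (π g) (π g) (ω g) (ω' g)
    rw [S.gap_self, zero_add] at h1
    have h2 := S.gap_le (ω g) (ω' g)
    have h3 : (S.size X : ℝ) = k * O.ncard + S.size W := by rw [hsize, hP]; push_cast; ring
    rw [h3]
    refine (h1.trans_le h2).trans (by linarith)

end SurgerySystem

namespace SurgerySystem

variable {ι : Type*} {C : ι → Type*} [∀ i, Group (C i)] {H : Type*} [Group H] [Fintype H]
  {T : Type*} [Fintype T] [MulAction (MulAut H) T] (S : SurgerySystem C H T)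
  {G : Type*} [Group G] {i : H →* G} {θ : G →* MulAut H}

/-- A sequence of representations of a stable group can be cut down by small amounts to
representations of smaller members, unless these amounts are relatively large, in which case the
members are reduced to size zero. -/
theorem exists_cut (hG : IsStableWrt C S.dist G) (A : ℕ → ι) (N : ℕ → ℕ)
    (hN : ∀ n, S.size (A n) ≤ N n) (α : ∀ n, G →* C (A n)) (q : ℕ → ℕ)
    (hq : Negl N fun n => q n) :
    ∃ (Y Z : ℕ → ι) (J : ∀ n, C (Y n) × C (Z n) →* C (A n)) (η : ∀ n, G →* C (Y n)),
      (∀ n, S.IsSplitting (J n)) ∧ (∀ n, S.size (Y n) ≤ S.size (A n) - q n) ∧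
      ∀ g, Negl N fun n => S.gap (α n g) ((J n).comp ((η n).prod 1) g) := by
  set δ : ℕ → ℝ := fun n => √(q n / N n) with hδ
  have hδ0 : ∀ n, 0 ≤ δ n := fun n => Real.sqrt_nonneg _
  have hδlim : Tendsto δ atTop (𝓝 0) := by
    have : Tendsto δ atTop (𝓝 (√0)) := (Real.continuous_sqrt.tendsto 0).comp hq
    rwa [Real.sqrt_zero] at this
  have hqδ : ∀ n, 0 < N n → (q n : ℝ) = δ n * δ n * N n := fun n hn => by
    rw [hδ, Real.mul_self_sqrt (by positivity)]
    field_simp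
  set k : ℕ → ℕ := fun n =>
    if (q n : ℝ) ≤ δ n * S.size (A n) then S.size (A n) - q n else 0 with hk
  have hkle : ∀ n, k n ≤ S.size (A n) - q n := fun n => by
    simp only [hk]; split_ifs <;> omega
  choose Y Z J hJ hY using fun n =>
    S.exists_splitting_size (A n) (k n) ((hkle n).trans (Nat.sub_le _ _))
  have hsize : ∀ n, (S.size (A n) : ℝ) = k n + S.size (Z n) := fun n => by
    have := (hJ n).size_eq
    rw [hY] at this
    exact_mod_cast this
  have hZN : ∀ n, (S.size (Z n) : ℝ) ≤ δ n * N n := fun n => by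
    have hle : (S.size (A n) : ℝ) ≤ N n := by exact_mod_cast hN n
    have hs := hsize n
    by_cases h : (q n : ℝ) ≤ δ n * S.size (A n)
    · have h1 : (S.size (A n) : ℝ) ≤ k n + q n := by
        have : S.size (A n) ≤ k n + q n := by simp only [hk, if_pos h]; omega
        exact_mod_cast this
      nlinarith [hδ0 n]
    · have hk0 : k n = 0 := by simp only [hk, if_neg h]
      rw [hk0] at hs
      rcases Nat.eq_zero_or_pos (N n) with h0 | h0
      · rw [h0] at hle ⊢
        push_cast at hle hs ⊢
        linarith
      · rw [hqδ n h0] at h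
        push_cast at hs
        by_contra hcon
        push Not at hcon h
        nlinarith [hδ0 n]
  have hZnegl : Negl N fun n => S.size (Z n) := by
    refine squeeze_zero (fun n => by positivity) (fun n => ?_) hδlim
    rcases Nat.eq_zero_or_pos (N n) with h0 | h0
    · simpa [h0] using hδ0 n
    · rw [div_le_iff₀ (by exact_mod_cast h0)]
      exact hZN n
  choose y hy using fun n g => (hJ n).near (α n g)
  have hmul : ∀ a b n, S.gap (y n a * y n b) (y n (a * b)) ≤ 80 * S.size (Z n) := by
    intro a b n
    have h1 := (hJ n).gap_eq (y n a * y n b) (y n (a * b)) 1 1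
    rw [S.gap_self, add_zero] at h1
    rw [← h1]
    have h2 : J n (y n a * y n b, 1) = J n (y n a, 1) * J n (y n b, 1) := by
      rw [← map_mul]; simp
    rw [h2]
    have h3 := S.gap_mul_mul_le (J n (y n a, 1)) (α n a) (J n (y n b, 1)) (α n b)
    have h4 := S.gap_triangle (J n (y n a, 1) * J n (y n b, 1)) (α n a * α n b)
      (J n (y n (a * b), 1))
    have h5 := hy n (a * b)
    rw [map_mul] at h5
    have h6 := hy n a
    have h7 := hy n b
    rw [S.gap_comm] at h6 h7
    linarith
  have hyd : ∀ a b : G, Tendsto (fun n => S.dist (Y n) (y n a * y n b) (y n (a * b)))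
      atTop (𝓝 0) := by
    intro a b
    have hlim : Tendsto (fun n => 160 * δ n) atTop (𝓝 0) := by
      simpa using hδlim.const_mul 160
    refine squeeze_zero' (Eventually.of_forall fun n =>
      div_nonneg (S.gap_nonneg _ _) (Nat.cast_nonneg _)) ?_ hlim
    filter_upwards [hδlim.eventually (ge_mem_nhds (show (0 : ℝ) < 1 / 2 by norm_num))] with n hn
    rcases Nat.eq_zero_or_pos (S.size (Y n)) with h0 | h0
    · simp [dist, h0, hδ0 n]
    · rw [dist, div_le_iff₀ (by exact_mod_cast h0)]
      refine (hmul a b n).trans ?_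
      have hs := hsize n
      rw [hY] at h0 ⊢
      by_cases h : (q n : ℝ) ≤ δ n * S.size (A n)
      · have h1 : (S.size (A n) : ℝ) ≤ k n + q n := by
          have : S.size (A n) ≤ k n + q n := by simp only [hk, if_pos h]; omega
          exact_mod_cast this
        have hA0 : (0 : ℝ) ≤ S.size (A n) := Nat.cast_nonneg _
        have h2 : (S.size (A n) : ℝ) ≤ 2 * k n := by nlinarith
        have h3 : δ n * S.size (A n) ≤ δ n * (2 * k n) := mul_le_mul_of_nonneg_left h2 (hδ0 n)
        nlinarith
      · simp only [hk, if_neg h] at h0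
        omega
  obtain ⟨η, hη⟩ := hG Y y hyd
  refine ⟨Y, Z, J, η, hJ, fun n => (hY n).trans_le (hkle n), fun g => ?_⟩
  have h1 : Negl N fun n => S.gap (y n g) (η n g) :=
    Negl.mono_size (N' := fun n => S.size (Y n)) (hη g) (fun n => S.gap_nonneg _ _)
      (fun n => ((hY n).trans_le (hkle n)).trans ((Nat.sub_le _ _).trans (hN n)))
      (fun n hn => S.gap_eq_zero_of_size hn _ _)
  refine ((hZnegl.const_mul 16).add (h1.const_mul 2)).of_le (fun n => S.gap_nonneg _ _)
    fun n => ?_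
  have h2 := S.gap_triangle (α n g) (J n (y n g, 1)) (J n (η n g, 1))
  have h3 := (hJ n).gap_eq (y n g) (η n g) 1 1
  rw [S.gap_self, add_zero] at h3
  have h4 := hy n g
  simp only [MonoidHom.comp_apply, MonoidHom.prod_apply, MonoidHom.one_apply]
  linarith

/-- Lowering the multiplicity of an orbit of types in a sequence of representations in which no
other types occur. -/
theorem exists_lower_of_pure (hG : IsStableWrt C S.dist G)
    (hθ : ∀ g h, i (θ g h) = g * i h * g⁻¹) {σ : T} (hσ : σ ≠ S.triv) (A : ℕ → ι) (N : ℕ → ℕ)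
    (hN : ∀ n, S.size (A n) ≤ N n) (α : ∀ n, G →* C (A n)) (f t : ℕ → ℕ)
    (hf : ∀ n τ, S.mult ((α n).comp i) τ = (typeOrbit θ σ).indicator (fun _ => f n) τ)
    (htf : ∀ n, t n ≤ f n) {L : ℕ} (hL : 0 < L) (hLfill : L ∈ S.fillers i (typeOrbit θ σ))
    (hLt : ∀ n, t n ≠ f n → L ∣ t n) (hnegl : Negl N fun n => (f n : ℝ) - t n) :
    ∃ α' : ∀ n, G →* C (A n), (∀ n, ∀ τ ≠ S.triv,
        S.mult ((α' n).comp i) τ = (typeOrbit θ σ).indicator (fun _ => t n) τ) ∧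
      ∀ g, Negl N fun n => S.gap (α n g) (α' n g) := by
  obtain ⟨M, hM⟩ := AddSubmonoid.exists_forall_sub_mem _ hL hLfill
  set O := typeOrbit θ σ with hO
  set c := O.ncard with hc
  have hσO : σ ∈ O := mem_typeOrbit_self θ σ
  have hc0 : 0 < c := (Set.ncard_pos (Set.toFinite O)).2 ⟨σ, hσO⟩
  have hsize : ∀ n, S.size (A n) = f n * c := fun n =>
    S.size_eq_of_mult_eq_indicator _ (hf n)
  have hq : Negl N fun n => (((M + 1) * (f n - t n) * c : ℕ) : ℝ) := by
    have h := hnegl.const_mul ((M + 1) * c)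
    refine h.of_le (fun n => Nat.cast_nonneg _) fun n => ?_
    rw [Nat.cast_mul, Nat.cast_mul, Nat.cast_sub (htf n)]
    push_cast
    exact le_of_eq (by ring)
  obtain ⟨Y, Z, J, η, hJ, hY, hη⟩ := S.exists_cut hG A N hN α _ hq
  set ξ : ∀ n, G →* C (A n) := fun n => (J n).comp ((η n).prod 1) with hξ
  set s : ℕ → ℕ := fun n => S.mult ((ξ n).comp i) σ with hs
  have hsum : Negl N fun n => ∑ h, S.gap (α n (i h)) (ξ n (i h)) :=
    Negl.sum _ fun h _ => hη (i h)
  have hfs : ∀ n, (f n : ℝ) - s n ≤ ∑ h, S.gap (α n (i h)) (ξ n (i h)) := fun n => by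
    have := S.mult_sub_le ((α n).comp i) ((ξ n).comp i) σ
    rwa [hf, Set.indicator_of_mem hσO] at this
  have hsη : ∀ n, S.mult ((η n).comp i) σ = s n := fun n => by
    have := (hJ n).mult_eq ((η n).comp i) 1 σ
    rw [S.mult_one σ hσ, add_zero] at this
    exact this.symm
  have hsY : ∀ n, s n * c ≤ S.size (Y n) := fun n =>
    S.mul_ncard_le_size ((η n).comp i) fun τ hτ => (S.mult_eq_of_mem hθ (η n) hτ).trans (hsη n)
  have hstep : ∀ n, ∃ ζ : G →* C (A n), (∀ τ ≠ S.triv,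
        S.mult (ζ.comp i) τ = O.indicator (fun _ => t n) τ) ∧
      ∀ g, S.gap (α n g) (ζ g) ≤
        2 * S.gap (α n g) (ξ n g) + 8 * c * ∑ h, S.gap (α n (i h)) (ξ n (i h)) := by
    intro n
    have hnn : 0 ≤ ∑ h, S.gap (α n (i h)) (ξ n (i h)) :=
      Finset.sum_nonneg fun h _ => S.gap_nonneg _ _
    by_cases htn : t n = f n
    · refine ⟨α n, fun τ _ => by rw [hf, htn], fun g => ?_⟩
      rw [S.gap_self]
      have := S.gap_nonneg (α n g) (ξ n g)
      positivity
    · have htf' := htf n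
      have hst : s n = 0 ∨ s n + M ≤ t n := by
        by_contra hcon
        push Not at hcon
        have h1 : s n * c ≤ f n * c - (M + 1) * (f n - t n) * c :=
          (hsY n).trans ((hY n).trans (by rw [hsize]))
        rw [← Nat.sub_mul] at h1
        have h2 := Nat.le_of_mul_le_mul_right h1 hc0
        obtain ⟨d, hd⟩ : ∃ d, f n = t n + d + 1 := ⟨f n - t n - 1, by omega⟩
        have h3 : f n - t n = d + 1 := by omega
        rw [h3] at h2
        have h4 : (M + 1) * (d + 1) = M + (d + 1) + M * d := by ring
        rw [h4] at h2
        omega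
      have hfill : t n - s n ∈ S.fillers i O := by
        rcases hst with h | h
        · rw [h, Nat.sub_zero]
          obtain ⟨d, hd⟩ := hLt n htn
          rw [hd, mul_comm]
          exact AddSubmonoid.nsmul_mem _ hLfill d
        · exact hM _ (S.mem_fillers hθ (ξ n)) _ (hLt n htn) h
      obtain ⟨ζ, hζ, hζgap⟩ := S.exists_raise hθ (ξ n) (t := t n) (show s n ≤ t n by omega)
        (by rw [hsize]; exact Nat.mul_le_mul_right _ htf') hfill
      refine ⟨ζ, hζ, fun g => ?_⟩
      have h1 := S.gap_triangle (α n g) (ξ n g) (ζ g)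
      have h2 := hζgap g
      rw [hsize] at h2
      have h3 : (4 : ℝ) * (((f n * c : ℕ) : ℝ) - s n * c) = 4 * c * ((f n : ℝ) - s n) := by
        push_cast; ring
      have h4 : 4 * (c : ℝ) * ((f n : ℝ) - s n) ≤ 4 * c * _ :=
        mul_le_mul_of_nonneg_left (hfs n) (by positivity)
      have h5 := h2.trans (h3.trans_le h4)
      linarith
  choose α' hα' hgap using hstep
  refine ⟨α', hα', fun g => ?_⟩
  exact (((hη g).const_mul 2).add (hsum.const_mul (8 * c))).of_le (fun n => S.gap_nonneg _ _)
    fun n => hgap n g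

/-- Lowering the multiplicity of one orbit of types in a sequence of representations. -/
theorem exists_lower_orbit (hG : IsStableWrt C S.dist G)
    (hθ : ∀ g h, i (θ g h) = g * i h * g⁻¹) {σ : T} (hσ : σ ≠ S.triv) (X : ℕ → ι)
    (ψ : ∀ n, G →* C (X n)) (t : ℕ → ℕ) (htf : ∀ n, t n ≤ S.mult ((ψ n).comp i) σ)
    {L : ℕ} (hL : 0 < L)
    (hLfill : (∃ k ∈ S.fillers i (typeOrbit θ σ), 0 < k) → L ∈ S.fillers i (typeOrbit θ σ))
    (hLt : ∀ n, t n ≠ S.mult ((ψ n).comp i) σ → L ∣ t n)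
    (hnegl : Negl (fun n => S.size (X n)) fun n => (S.mult ((ψ n).comp i) σ : ℝ) - t n) :
    ∃ ψ' : ∀ n, G →* C (X n),
      (∀ n, ∀ τ ∈ typeOrbit θ σ, S.mult ((ψ' n).comp i) τ = t n) ∧
      (∀ n, ∀ τ ≠ S.triv, τ ∉ typeOrbit θ σ →
        S.mult ((ψ' n).comp i) τ = S.mult ((ψ n).comp i) τ) ∧
      ∀ g, Negl (fun n => S.size (X n)) fun n => S.gap (ψ n g) (ψ' n g) := by
  have htriv := S.triv_notMem_typeOrbit θ hσ
  by_cases hpos : ∃ n, 0 < S.mult ((ψ n).comp i) σ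
  swap
  · push Not at hpos
    refine ⟨ψ, fun n τ hτ => ?_, fun _ _ _ _ => rfl, fun g => ?_⟩
    · rw [S.mult_eq_of_mem hθ _ hτ]
      have := hpos n
      have := htf n
      omega
    · simpa only [S.gap_self] using Negl.zero _
  have hLO : L ∈ S.fillers i (typeOrbit θ σ) := by
    obtain ⟨n, hn⟩ := hpos
    exact hLfill ⟨_, S.mem_fillers hθ (ψ n), hn⟩
  choose A B J α β hJ hψ hα hβ using fun n =>
    S.exists_splitting_of_invariant hθ (ψ n) _ (smul_mem_typeOrbit θ σ)
  have hadd : ∀ n τ, S.mult ((ψ n).comp i) τ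
      = S.mult ((α n).comp i) τ + S.mult ((β n).comp i) τ := fun n τ => by
    rw [← (hJ n).mult_eq, ← hψ n]; rfl
  have hf : ∀ n τ, S.mult ((α n).comp i) τ
      = (typeOrbit θ σ).indicator (fun _ => S.mult ((ψ n).comp i) σ) τ := fun n τ => by
    by_cases hτ : τ ∈ typeOrbit θ σ
    · rw [Set.indicator_of_mem hτ, ← S.mult_eq_of_mem hθ (ψ n) hτ, hadd, hβ n τ hτ, add_zero]
    · rw [Set.indicator_of_notMem hτ, hα n τ hτ]
  obtain ⟨α', hα', hgap⟩ := S.exists_lower_of_pure hG hθ hσ A (fun n => S.size (X n))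
    (fun n => by rw [(hJ n).size_eq]; exact Nat.le_add_right _ _) α _ t hf htf hL hLO hLt hnegl
  refine ⟨fun n => (J n).comp ((α' n).prod (β n)), fun n τ hτ => ?_, fun n τ hτt hτ => ?_,
    fun g => ?_⟩
  · have := (hJ n).mult_eq ((α' n).comp i) ((β n).comp i) τ
    rw [hα' n τ (fun h => htriv (h ▸ hτ)), Set.indicator_of_mem hτ, hβ n τ hτ] at this
    exact this
  · have := (hJ n).mult_eq ((α' n).comp i) ((β n).comp i) τ
    rw [hα' n τ hτt, Set.indicator_of_notMem hτ, ← hα n τ hτ, ← hadd] at this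
    exact this
  · refine (hgap g).of_le (fun n => S.gap_nonneg _ _) fun n => ?_
    have := (hJ n).gap_eq (α n g) (α' n g) (β n g) (β n g)
    rw [S.gap_self, add_zero] at this
    rw [← this, ← hψ n]
    rfl

/-- Lowering the multiplicities of all nontrivial types in a sequence of representations. -/
theorem exists_lower (hG : IsStableWrt C S.dist G)
    (hθ : ∀ g h, i (θ g h) = g * i h * g⁻¹) (X : ℕ → ι)
    (ψ : ∀ n, G →* C (X n)) (t : ℕ → T → ℕ) (htθ : ∀ n g τ, t n (θ g • τ) = t n τ)
    (htf : ∀ n, ∀ τ ≠ S.triv, t n τ ≤ S.mult ((ψ n).comp i) τ) {L : ℕ} (hL : 0 < L)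
    (hLfill : ∀ σ, (∃ k ∈ S.fillers i (typeOrbit θ σ), 0 < k) →
      L ∈ S.fillers i (typeOrbit θ σ))
    (hLt : ∀ n, ∀ τ ≠ S.triv, t n τ ≠ S.mult ((ψ n).comp i) τ → L ∣ t n τ)
    (hnegl : ∀ τ ≠ S.triv, Negl (fun n => S.size (X n))
      fun n => (S.mult ((ψ n).comp i) τ : ℝ) - t n τ) :
    ∃ ψ' : ∀ n, G →* C (X n), (∀ n, ∀ τ ≠ S.triv, S.mult ((ψ' n).comp i) τ = t n τ) ∧
      ∀ g, Negl (fun n => S.size (X n)) fun n => S.gap (ψ n g) (ψ' n g) := by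
  classical
  have main : ∀ s : Finset T, ∃ ψ' : ∀ n, G →* C (X n),
      (∀ n, ∀ τ ∈ s, τ ≠ S.triv → S.mult ((ψ' n).comp i) τ = t n τ) ∧
      (∀ n, ∀ τ ≠ S.triv, S.mult ((ψ' n).comp i) τ = t n τ ∨
        S.mult ((ψ' n).comp i) τ = S.mult ((ψ n).comp i) τ) ∧
      ∀ g, Negl (fun n => S.size (X n)) fun n => S.gap (ψ n g) (ψ' n g) := by
    intro s
    induction s using Finset.induction_on with
    | empty =>
      refine ⟨ψ, fun n τ hτ => absurd hτ (Finset.notMem_empty _), fun _ _ _ => Or.inr rfl,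
        fun g => ?_⟩
      simpa only [S.gap_self] using Negl.zero _
    | insert σ s hs ih =>
      obtain ⟨χ, hχs, hχ, hχgap⟩ := ih
      by_cases hσ : σ = S.triv
      · refine ⟨χ, fun n τ hτ hτt => ?_, hχ, hχgap⟩
        rcases Finset.mem_insert.1 hτ with rfl | h
        · exact absurd hσ hτt
        · exact hχs n τ h hτt
      · obtain ⟨ψ', h1, h2, h3⟩ := S.exists_lower_orbit hG hθ hσ X χ (fun n => t n σ)
          (fun n => by rcases hχ n σ hσ with h | h <;> rw [h]; exact htf n σ hσ) hL (hLfill σ)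
          (fun n hn => by
            rcases hχ n σ hσ with h | h
            · exact absurd h.symm hn
            · exact hLt n σ hσ (h ▸ hn))
          ((hnegl σ hσ).of_le (fun n => by
              rcases hχ n σ hσ with h | h
              · simp [h]
              · rw [h, sub_nonneg]; exact_mod_cast htf n σ hσ)
            (fun n => by
              rcases hχ n σ hσ with h | h
              · rw [h, sub_self, sub_nonneg]; exact_mod_cast htf n σ hσ
              · rw [h]))
        have horb : ∀ n, ∀ τ ∈ typeOrbit θ σ, t n σ = t n τ := by
          rintro n _ ⟨g, rfl⟩
          exact (htθ n g σ).symm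
        refine ⟨ψ', fun n τ hτ hτt => ?_, fun n τ hτt => ?_, fun g => ?_⟩
        · by_cases hO : τ ∈ typeOrbit θ σ
          · rw [h1 n τ hO, horb n τ hO]
          · rcases Finset.mem_insert.1 hτ with rfl | h
            · exact absurd (mem_typeOrbit_self θ τ) hO
            · rw [h2 n τ hτt hO, hχs n τ h hτt]
        · by_cases hO : τ ∈ typeOrbit θ σ
          · exact Or.inl (by rw [h1 n τ hO, horb n τ hO])
          · rw [h2 n τ hτt hO]
            exact hχ n τ hτt
        · exact (((hχgap g).const_mul 2).add ((h3 g).const_mul 2)).of_le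
            (fun n => S.gap_nonneg _ _) fun n => by
              have := S.gap_triangle (ψ n g) (χ n g) (ψ' n g)
              linarith
  obtain ⟨ψ', h1, -, h3⟩ := main Finset.univ
  exact ⟨ψ', fun n τ hτ => h1 n τ (Finset.mem_univ _) hτ, h3⟩

end SurgerySystem

/-- A group acts by conjugation on a group embedded as a normal subgroup. -/
theorem exists_conj_action {H G : Type*} [Group H] [Group G] (i : H →* G)
    (hi : Function.Injective i) (hn : i.range.Normal) :
    ∃ θ : G →* MulAut H, ∀ g h, i (θ g h) = g * i h * g⁻¹ := by
  let e := MonoidHom.ofInjective hi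
  refine ⟨(MulAut.congr e.symm).toMonoidHom.comp MulAut.conjNormal, fun g h => ?_⟩
  have h1 := MonoidHom.apply_ofInjective_symm hi (MulAut.conjNormal g (e h))
  have h2 : ((e h : i.range) : G) = i h := MonoidHom.ofInjective_apply hi
  rw [MulAut.conjNormal_apply, h2] at h1
  exact h1

namespace AmalgamatedProduct

variable {H G₁ G₂ : Type*} [Group H] [Group G₁] [Group G₂] (i₁ : H →* G₁) (i₂ : H →* G₂)

/-- The canonical map of the first factor. -/
def inl : G₁ →* AmalgamatedProduct i₁ i₂ := (QuotientGroup.mk' _).comp Monoid.Coprod.inl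

/-- The canonical map of the second factor. -/
def inr : G₂ →* AmalgamatedProduct i₁ i₂ := (QuotientGroup.mk' _).comp Monoid.Coprod.inr

theorem inl_eq_inr (h : H) : inl i₁ i₂ (i₁ h) = inr i₁ i₂ (i₂ h) := by
  rw [← mul_inv_eq_one]
  have : (QuotientGroup.mk' _ (Monoid.Coprod.inl (i₁ h) * (Monoid.Coprod.inr (i₂ h))⁻¹) :
      AmalgamatedProduct i₁ i₂) = 1 :=
    (QuotientGroup.eq_one_iff _).2 (Subgroup.subset_normalClosure ⟨h, rfl⟩)
  rw [map_mul, map_inv] at this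
  exact this

variable {i₁ i₂}

theorem induction_on {p : AmalgamatedProduct i₁ i₂ → Prop} (a : AmalgamatedProduct i₁ i₂)
    (hl : ∀ g, p (inl i₁ i₂ g)) (hr : ∀ g, p (inr i₁ i₂ g))
    (hmul : ∀ x y, p x → p y → p (x * y)) : p a := by
  obtain ⟨x, rfl⟩ := QuotientGroup.mk_surjective a
  induction x using Monoid.Coprod.induction_on with
  | inl g => exact hl g
  | inr g => exact hr g
  | mul x y hx hy => exact hmul _ _ hx hy

theorem exists_lift {K : Type*} [Group K] (f₁ : G₁ →* K) (f₂ : G₂ →* K)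
    (hf : ∀ h, f₁ (i₁ h) = f₂ (i₂ h)) :
    ∃ F : AmalgamatedProduct i₁ i₂ →* K,
      (∀ g, F (inl i₁ i₂ g) = f₁ g) ∧ ∀ g, F (inr i₁ i₂ g) = f₂ g := by
  refine ⟨QuotientGroup.lift _ (Monoid.Coprod.lift f₁ f₂) ?_, fun g => ?_, fun g => ?_⟩
  · intro x hx
    refine Subgroup.normalClosure_le_normal (N := (Monoid.Coprod.lift f₁ f₂).ker) ?_ hx
    rintro _ ⟨h, rfl⟩
    simp [MonoidHom.mem_ker, hf]
  · simp [inl]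
  · simp [inr]

end AmalgamatedProduct

namespace SurgerySystem

variable {ι : Type*} {C : ι → Type*} [∀ i, Group (C i)] {H : Type*} [Group H] [Fintype H]
  {T : Type*} [Fintype T] [MulAction (MulAut H) T] (S : SurgerySystem C H T)
  {G₁ G₂ : Type*} [Group G₁] [Group G₂] {i₁ : H →* G₁} {i₂ : H →* G₂}
  {θ₁ : G₁ →* MulAut H} {θ₂ : G₂ →* MulAut H}

theorem exists_filler {G : Type*} [Group G] (i : H →* G) (θ : G →* MulAut H) :
    ∃ L : ℕ, 0 < L ∧ ∀ L', L ∣ L' → ∀ σ, (∃ k ∈ S.fillers i (typeOrbit θ σ), 0 < k) →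
      L' ∈ S.fillers i (typeOrbit θ σ) := by
  have : ∀ σ, ∃ k : ℕ, 0 < k ∧ ((∃ k ∈ S.fillers i (typeOrbit θ σ), 0 < k) →
      k ∈ S.fillers i (typeOrbit θ σ)) := fun σ => by
    by_cases h : ∃ k ∈ S.fillers i (typeOrbit θ σ), 0 < k
    · obtain ⟨k, hk, hk0⟩ := h
      exact ⟨k, hk0, fun _ => hk⟩
    · exact ⟨1, one_pos, fun h' => absurd h' h⟩
  choose k hk0 hk using this
  refine ⟨∏ σ, k σ, Finset.prod_pos fun σ _ => hk0 σ, fun L' hL' σ hσ => ?_⟩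
  obtain ⟨d, rfl⟩ := (Finset.dvd_prod_of_mem k (Finset.mem_univ σ)).trans hL'
  rw [mul_comm]
  exact AddSubmonoid.nsmul_mem _ (hk σ hσ) d

/-- Two sequences of multiplicity functions that are asymptotically equal and invariant under two
groups of automorphisms have a common approximation from below that is invariant under both. -/
theorem exists_common_mult (N : ℕ → ℕ) (f₁ f₂ : ℕ → T → ℕ)
    (h₁ : ∀ n g τ, f₁ n (θ₁ g • τ) = f₁ n τ) (h₂ : ∀ n g τ, f₂ n (θ₂ g • τ) = f₂ n τ)
    (hf : ∀ τ, Negl N fun n => (f₁ n τ : ℝ) - f₂ n τ) {L : ℕ} (hL : 0 < L) :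
    ∃ t : ℕ → T → ℕ, (∀ n g τ, t n (θ₁ g • τ) = t n τ) ∧ (∀ n g τ, t n (θ₂ g • τ) = t n τ) ∧
      (∀ n τ, t n τ ≤ f₁ n τ ∧ t n τ ≤ f₂ n τ) ∧
      (∀ n, (∀ τ, t n τ = f₁ n τ ∧ t n τ = f₂ n τ) ∨ ∀ τ, L ∣ t n τ) ∧
      (∀ τ, Negl N fun n => (f₁ n τ : ℝ) - t n τ) ∧
      ∀ τ, Negl N fun n => (f₂ n τ : ℝ) - t n τ := by
  classical
  let Γ : Subgroup (MulAut H) := Subgroup.closure (Set.range θ₁ ∪ Set.range θ₂)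
  have hΓ₁ : ∀ g, θ₁ g ∈ Γ := fun g => Subgroup.subset_closure (Or.inl ⟨g, rfl⟩)
  have hΓ₂ : ∀ g, θ₂ g ∈ Γ := fun g => Subgroup.subset_closure (Or.inr ⟨g, rfl⟩)
  have : Finite (MulAut H) := Finite.of_injective (fun α : MulAut H => (α : H → H))
    DFunLike.coe_injective
  have := Fintype.ofFinite Γ
  have hvar : ∀ α ∈ Γ, ∀ τ, Negl N fun n => (f₁ n τ : ℝ) - f₁ n (α • τ) := by
    intro α hα
    induction hα using Subgroup.closure_induction with
    | mem α hα =>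
      intro τ
      rcases hα with ⟨g, rfl⟩ | ⟨g, rfl⟩
      · simpa only [h₁, sub_self] using Negl.zero N
      · have := (hf τ).add ((hf (θ₂ g • τ)).const_mul (-1))
        simp only [h₂] at this
        convert this using 2
        ring
    | one => intro τ; simpa using Negl.zero N
    | mul α β _ _ hα hβ =>
      intro τ
      convert (hβ τ).add (hα (β • τ)) using 2
      rw [mul_smul]; ring
    | inv α _ hα =>
      intro τ
      convert (hα (α⁻¹ • τ)).const_mul (-1) using 2
      rw [smul_inv_smul]; ring
  let m : ℕ → T → ℕ := fun n τ =>
    Finset.univ.inf' ⟨(1 : Γ), Finset.mem_univ _⟩ fun α : Γ => min (f₁ n (α • τ)) (f₂ n (α • τ))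
  have hm_le : ∀ n τ (α : Γ), m n τ ≤ min (f₁ n (α • τ)) (f₂ n (α • τ)) := fun n τ α =>
    Finset.inf'_le (fun α : Γ => min (f₁ n (α • τ)) (f₂ n (α • τ))) (Finset.mem_univ α)
  have hm_mono : ∀ n τ (β : Γ), m n τ ≤ m n (β • τ) := fun n τ β =>
    Finset.le_inf' _ _ fun α _ => by
      rw [smul_smul]; exact hm_le n τ (α * β)
  have hm_inv : ∀ n τ (β : Γ), m n (β • τ) = m n τ := fun n τ β =>
    le_antisymm (by simpa using hm_mono n (β • τ) β⁻¹) (hm_mono n τ β)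
  have hm1 : ∀ n τ, m n τ ≤ f₁ n τ ∧ m n τ ≤ f₂ n τ := fun n τ => by
    simpa using hm_le n τ 1
  let t : ℕ → T → ℕ := fun n τ => if ∀ τ, f₁ n τ = f₂ n τ then f₁ n τ else L * (m n τ / L)
  have ht_pos : ∀ n, (∀ τ, f₁ n τ = f₂ n τ) → ∀ τ, t n τ = f₁ n τ := fun n h τ => if_pos h
  have ht_neg : ∀ n, (¬ ∀ τ, f₁ n τ = f₂ n τ) → ∀ τ, t n τ = L * (m n τ / L) :=
    fun n h τ => if_neg h
  have hD : ∀ n, 0 ≤ ∑ τ, |(f₁ n τ : ℝ) - f₂ n τ| := fun n =>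
    Finset.sum_nonneg fun _ _ => abs_nonneg _
  have hneg1 : ∀ τ, Negl N fun n => (f₁ n τ : ℝ) - t n τ := by
    intro τ
    have hb : Negl N fun n => (L : ℝ) * (∑ τ, |(f₁ n τ : ℝ) - f₂ n τ|) +
        ∑ α : Γ, (|(f₁ n τ : ℝ) - f₁ n (α • τ)| + |(f₁ n (α • τ) : ℝ) - f₂ n (α • τ)|) :=
      ((Negl.sum _ fun τ _ => (hf τ).abs).const_mul L).add
        (Negl.sum _ fun α _ => (hvar α α.2 τ).abs.add (hf _).abs)
    refine hb.of_abs_le fun n => ?_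
    have hsum : 0 ≤ ∑ α : Γ,
        (|(f₁ n τ : ℝ) - f₁ n (α • τ)| + |(f₁ n (α • τ) : ℝ) - f₂ n (α • τ)|) :=
      Finset.sum_nonneg fun _ _ => by positivity
    by_cases h : ∀ τ, f₁ n τ = f₂ n τ
    · rw [ht_pos n h, sub_self, abs_zero]
      have := hD n
      positivity
    · rw [ht_neg n h]
      have h1 : (1 : ℝ) ≤ ∑ τ, |(f₁ n τ : ℝ) - f₂ n τ| := by
        push Not at h
        obtain ⟨σ, hσ⟩ := h
        refine le_trans ?_ (Finset.single_le_sum (f := fun τ => |(f₁ n τ : ℝ) - f₂ n τ|)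
          (fun _ _ => abs_nonneg _) (Finset.mem_univ σ))
        have : (1 : ℤ) ≤ |(f₁ n σ : ℤ) - f₂ n σ| := Int.one_le_abs (by omega)
        exact_mod_cast this
      have h2 : (m n τ : ℝ) ≤ (L * (m n τ / L) : ℕ) + L := by
        have h3 := Nat.div_add_mod (m n τ) L
        have h4 := Nat.mod_lt (m n τ) hL
        have : m n τ ≤ L * (m n τ / L) + L := by omega
        exact_mod_cast this
      obtain ⟨α, -, hα⟩ := Finset.exists_mem_eq_inf' (s := Finset.univ)
        ⟨(1 : Γ), Finset.mem_univ _⟩ fun α : Γ => min (f₁ n (α • τ)) (f₂ n (α • τ))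
      have h3 : (f₁ n τ : ℝ) - m n τ ≤
          |(f₁ n τ : ℝ) - f₁ n (α • τ)| + |(f₁ n (α • τ) : ℝ) - f₂ n (α • τ)| := by
        have : (m n τ : ℝ) = min (f₁ n (α • τ) : ℝ) (f₂ n (α • τ)) := by
          rw [← Nat.cast_min]; exact congrArg _ hα
        rw [this]
        have h4 := le_abs_self ((f₁ n τ : ℝ) - f₁ n (α • τ))
        have h5 := le_abs_self ((f₁ n (α • τ) : ℝ) - f₂ n (α • τ))
        have h6 := abs_nonneg ((f₁ n (α • τ) : ℝ) - f₂ n (α • τ))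
        rcases min_choice (f₁ n (α • τ) : ℝ) (f₂ n (α • τ)) with h7 | h7 <;> rw [h7] <;> linarith
      have h4 := Finset.single_le_sum (f := fun α : Γ =>
        |(f₁ n τ : ℝ) - f₁ n (α • τ)| + |(f₁ n (α • τ) : ℝ) - f₂ n (α • τ)|)
          (fun _ _ => by positivity) (Finset.mem_univ α)
      have h5 : (L : ℝ) ≤ L * ∑ τ, |(f₁ n τ : ℝ) - f₂ n τ| :=
        le_mul_of_one_le_right (Nat.cast_nonneg _) h1
      have h6 : ((L * (m n τ / L) : ℕ) : ℝ) ≤ f₁ n τ := by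
        exact_mod_cast (Nat.mul_div_le _ _).trans (hm1 n τ).1
      rw [abs_of_nonneg (by linarith)]
      linarith
  refine ⟨t, fun n g τ => ?_, fun n g τ => ?_, fun n τ => ?_, fun n => ?_, hneg1, fun τ => ?_⟩
  · by_cases h : ∀ τ, f₁ n τ = f₂ n τ
    · rw [ht_pos n h, ht_pos n h, h₁]
    · rw [ht_neg n h, ht_neg n h, ← hm_inv n τ ⟨θ₁ g, hΓ₁ g⟩]; rfl
  · by_cases h : ∀ τ, f₁ n τ = f₂ n τ
    · rw [ht_pos n h, ht_pos n h, h, h, h₂]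
    · rw [ht_neg n h, ht_neg n h, ← hm_inv n τ ⟨θ₂ g, hΓ₂ g⟩]; rfl
  · by_cases h : ∀ τ, f₁ n τ = f₂ n τ
    · rw [ht_pos n h]; exact ⟨le_rfl, (h τ).le⟩
    · rw [ht_neg n h]
      exact ⟨(Nat.mul_div_le _ _).trans (hm1 n τ).1, (Nat.mul_div_le _ _).trans (hm1 n τ).2⟩
  · by_cases h : ∀ τ, f₁ n τ = f₂ n τ
    · exact Or.inl fun τ => ⟨ht_pos n h τ, (ht_pos n h τ).trans (h τ)⟩
    · exact Or.inr fun τ => by rw [ht_neg n h]; exact Dvd.intro _ rfl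
  · convert (hneg1 τ).add ((hf τ).const_mul (-1)) using 2
    ring

theorem isStableWrt_amalgamatedProduct (hθ₁ : ∀ g h, i₁ (θ₁ g h) = g * i₁ h * g⁻¹)
    (hθ₂ : ∀ g h, i₂ (θ₂ g h) = g * i₂ h * g⁻¹) (hG₁ : IsStableWrt C S.dist G₁)
    (hG₂ : IsStableWrt C S.dist G₂) : IsStableWrt C S.dist (AmalgamatedProduct i₁ i₂) := by
  intro X φ hφ
  set N : ℕ → ℕ := fun n => S.size (X n) with hN
  have hmul : ∀ a b, Negl N fun n => S.gap (φ n a * φ n b) (φ n (a * b)) := hφ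
  have hcomp : ∀ {u v w : ∀ n, C (X n)}, Negl N (fun n => S.gap (u n) (v n)) →
      Negl N (fun n => S.gap (v n) (w n)) → Negl N fun n => S.gap (u n) (w n) :=
    fun {u v w} h h' => ((h.const_mul 2).add (h'.const_mul 2)).of_le
      (fun n => S.gap_nonneg _ _) fun n => by
        have := S.gap_triangle (u n) (v n) (w n)
        linarith
  have hsymm : ∀ {u v : ∀ n, C (X n)}, Negl N (fun n => S.gap (u n) (v n)) →
      Negl N fun n => S.gap (v n) (u n) := fun {u v} h => by
    simpa only [S.gap_comm] using h
  obtain ⟨ψ₁, hψ₁⟩ := hG₁ X (fun n g => φ n (AmalgamatedProduct.inl i₁ i₂ g))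
    fun a b => by simpa only [map_mul] using hφ _ _
  obtain ⟨ψ₂, hψ₂⟩ := hG₂ X (fun n g => φ n (AmalgamatedProduct.inr i₁ i₂ g))
    fun a b => by simpa only [map_mul] using hφ _ _
  have hψ₁' : ∀ g, Negl N fun n => S.gap (φ n (AmalgamatedProduct.inl i₁ i₂ g)) (ψ₁ n g) := hψ₁
  have hψ₂' : ∀ g, Negl N fun n => S.gap (φ n (AmalgamatedProduct.inr i₁ i₂ g)) (ψ₂ n g) := hψ₂
  have hH : ∀ h, Negl N fun n => S.gap (ψ₁ n (i₁ h)) (ψ₂ n (i₂ h)) := fun h => by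
    refine hcomp (hsymm (hψ₁' (i₁ h))) ?_
    rw [AmalgamatedProduct.inl_eq_inr]
    exact hψ₂' (i₂ h)
  obtain ⟨L₁, hL₁, hfill₁⟩ := S.exists_filler i₁ θ₁
  obtain ⟨L₂, hL₂, hfill₂⟩ := S.exists_filler i₂ θ₂
  have hL : 0 < L₁ * L₂ := Nat.mul_pos hL₁ hL₂
  obtain ⟨t, ht₁, ht₂, htf, htL, hn₁, hn₂⟩ := exists_common_mult (θ₁ := θ₁) (θ₂ := θ₂) N
    (fun n => S.mult ((ψ₁ n).comp i₁)) (fun n => S.mult ((ψ₂ n).comp i₂))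
    (fun n => S.mult_smul hθ₁ (ψ₁ n)) (fun n => S.mult_smul hθ₂ (ψ₂ n))
    (fun τ => (Negl.sum _ fun h _ => hH h).of_abs_le fun n =>
      S.abs_mult_sub_le ((ψ₁ n).comp i₁) ((ψ₂ n).comp i₂) τ) hL
  obtain ⟨χ₁, hχ₁, hχ₁gap⟩ := S.exists_lower hG₁ hθ₁ X ψ₁ t ht₁ (fun n τ _ => (htf n τ).1) hL
    (hfill₁ _ (Dvd.intro _ rfl))
    (fun n τ _ hne => (htL n).elim (fun h => absurd (h τ).1 hne) fun h => h τ)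
    fun τ _ => hn₁ τ
  obtain ⟨χ₂, hχ₂, hχ₂gap⟩ := S.exists_lower hG₂ hθ₂ X ψ₂ t ht₂ (fun n τ _ => (htf n τ).2) hL
    (hfill₂ _ (Dvd.intro_left _ rfl))
    (fun n τ _ hne => (htL n).elim (fun h => absurd (h τ).2 hne) fun h => h τ)
    fun τ _ => hn₂ τ
  have hmult : ∀ n τ, S.mult ((χ₁ n).comp i₁) τ = S.mult ((χ₂ n).comp i₂) τ := by
    classical
    intro n τ
    by_cases hτ : τ = S.triv
    · subst hτ
      have h₁ := S.sum_mult ((χ₁ n).comp i₁)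
      have h₂ := S.sum_mult ((χ₂ n).comp i₂)
      rw [← Finset.add_sum_erase _ _ (Finset.mem_univ S.triv)] at h₁ h₂
      rw [Finset.sum_congr rfl fun τ hτ => hχ₁ n τ (Finset.ne_of_mem_erase hτ)] at h₁
      rw [Finset.sum_congr rfl fun τ hτ => hχ₂ n τ (Finset.ne_of_mem_erase hτ)] at h₂
      omega
    · rw [hχ₁ n τ hτ, hχ₂ n τ hτ]
  choose u hu hugap using fun n => S.exists_conj _ _ (hmult n)
  have hχ : ∀ h, Negl N fun n => S.gap (χ₁ n (i₁ h)) (χ₂ n (i₂ h)) := fun h =>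
    hcomp (hcomp (hsymm (hχ₁gap (i₁ h))) (hH h)) (hχ₂gap (i₂ h))
  have hu1 : Negl N fun n => S.gap (u n) 1 :=
    ((Negl.sum _ fun h _ => hχ h).const_mul 4).of_le (fun n => S.gap_nonneg _ _) hugap
  choose Ψ hΨ₁ hΨ₂ using fun n => AmalgamatedProduct.exists_lift (i₁ := i₁) (i₂ := i₂)
    ((MulAut.conj (u n)).toMonoidHom.comp (χ₁ n)) (χ₂ n) (hu n)
  refine ⟨Ψ, fun a => ?_⟩
  change Negl N fun n => S.gap (φ n a) (Ψ n a)
  induction a using AmalgamatedProduct.induction_on with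
  | hl g =>
    refine hcomp (hψ₁' g) (hcomp (hχ₁gap g) ?_)
    refine (hu1.const_mul 4).of_le (fun n => S.gap_nonneg _ _) fun n => ?_
    rw [hΨ₁]
    simp only [MonoidHom.comp_apply, MulEquiv.toMonoidHom_eq_coe, MonoidHom.coe_coe,
      MulAut.conj_apply]
    rw [← S.gap_mul_right (u n), inv_mul_cancel_right]
    have h1 := S.gap_triangle (χ₁ n g * u n) (χ₁ n g) (u n * χ₁ n g)
    have h2 := S.gap_mul_left (χ₁ n g) (u n) 1
    have h3 := S.gap_mul_right (χ₁ n g) 1 (u n)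
    rw [mul_one] at h2
    rw [one_mul, S.gap_comm 1] at h3
    linarith
  | hr g =>
    simp only [hΨ₂]
    exact hcomp (hψ₂' g) (hχ₂gap g)
  | hmul x y hx hy =>
    refine hcomp (hsymm (hmul x y)) ?_
    refine ((hx.const_mul 2).add (hy.const_mul 2)).of_le (fun n => S.gap_nonneg _ _) fun n => ?_
    have := S.gap_mul_mul_le (φ n x) (Ψ n x) (φ n y) (Ψ n y)
    rw [map_mul]
    linarith

end SurgerySystem

namespace PermSystem

open Equiv

variable {H : Type*} [Group H] {X A B : Type*}

/-- The stabilizer of a point under a permutation representation. -/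
def stab (ρ : H →* Perm X) (x : X) : Subgroup H := (MulAction.stabilizer (Perm X) x).comap ρ

@[simp]
theorem mem_stab {ρ : H →* Perm X} {x : X} {h : H} : h ∈ stab ρ x ↔ ρ h x = x := Iff.rfl

/-- The number of points with given stabilizer. -/
def stabCount (ρ : H →* Perm X) (K : Subgroup H) : ℕ := {x | stab ρ x = K}.ncard

/-- The number of points at which two permutations differ. -/
def diffCount (σ τ : Perm X) : ℕ := {x | σ x ≠ τ x}.ncard

theorem ncard_setOf_eq_of_equiv (e : X ≃ A) (p : X → Prop) :
    {x | p x}.ncard = {a | p (e.symm a)}.ncard :=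
  Nat.card_congr (e.subtypeEquiv fun x => by simp)

theorem ncard_setOf_eq_add [Finite A] [Finite B] (e : X ≃ A ⊕ B) (p : X → Prop) :
    {x | p x}.ncard = {a | p (e.symm (.inl a))}.ncard + {b | p (e.symm (.inr b))}.ncard := by
  rw [ncard_setOf_eq_of_equiv e]
  exact (Nat.card_congr (subtypeSum (p := fun y => p (e.symm y)))).trans Nat.card_sum

/-- The permutations preserving the parts of a decomposition into two parts. -/
def sumHom (e : X ≃ A ⊕ B) : Perm A × Perm B →* Perm X :=
  e.symm.permCongrHom.toMonoidHom.comp (Perm.sumCongrHom A B)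

@[simp]
theorem sumHom_inl (e : X ≃ A ⊕ B) (a : Perm A) (b : Perm B) (x : A) :
    sumHom e (a, b) (e.symm (.inl x)) = e.symm (.inl (a x)) := by
  simp [sumHom, permCongrHom]

@[simp]
theorem sumHom_inr (e : X ≃ A ⊕ B) (a : Perm A) (b : Perm B) (x : B) :
    sumHom e (a, b) (e.symm (.inr x)) = e.symm (.inr (b x)) := by
  simp [sumHom, permCongrHom]

theorem sumHom_injective (e : X ≃ A ⊕ B) : Function.Injective (sumHom e) :=
  e.symm.permCongrHom.injective.comp Perm.sumCongrHom_injective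

theorem diffCount_sumHom [Finite A] [Finite B] (e : X ≃ A ⊕ B) (a a' : Perm A) (b b' : Perm B) :
    diffCount (sumHom e (a, b)) (sumHom e (a', b')) = diffCount a a' + diffCount b b' := by
  rw [diffCount, ncard_setOf_eq_add e]
  simp [diffCount]

theorem stabCount_sumHom [Finite A] [Finite B] (e : X ≃ A ⊕ B) (ρ : H →* Perm A)
    (ρ' : H →* Perm B) (K : Subgroup H) :
    stabCount ((sumHom e).comp (ρ.prod ρ')) K = stabCount ρ K + stabCount ρ' K := by
  rw [stabCount, ncard_setOf_eq_add e]
  simp [stabCount, SetLike.ext_iff]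

theorem exists_diffCount_sumHom_le [Finite A] [Finite B] (e : X ≃ A ⊕ B) (x : Perm X) :
    ∃ a : Perm A, diffCount x (sumHom e (a, 1)) ≤ 2 * Nat.card B := by
  classical
  have := Fintype.ofFinite A
  let y : A → A ⊕ B := fun a => e (x (e.symm (.inl a)))
  have hy : Function.Injective y := fun a a' h => by simpa [y] using h
  let f : A → A := fun a => (y a).elim id fun _ => a
  have hf : ∀ a, (∃ a', y a = .inl a') → y a = .inl (f a) := by
    rintro a ⟨a', ha'⟩
    simp [f, ha']
  obtain ⟨g, hg⟩ := Set.MapsTo.exists_equiv_extend_of_card_eq (t := Finset.univ)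
    (s := {a | ∃ a', y a = .inl a'}) (f := f) Finset.card_univ.symm (fun _ _ => by simp)
    (fun a ha a' ha' h => hy (by rw [hf a ha, hf a' ha', h]))
  refine ⟨g.trans (subtypeUnivEquiv Finset.mem_univ), ?_⟩
  rw [diffCount, ncard_setOf_eq_add e, two_mul]
  have hB : ∀ s : Set B, s.ncard ≤ Nat.card B := fun s => by
    rw [← Set.ncard_univ]; exact Set.ncard_le_ncard (Set.subset_univ s)
  refine add_le_add ?_ (hB _)
  rcases isEmpty_or_nonempty B with hB0 | ⟨⟨b₀⟩⟩
  · rw [Nat.card_of_isEmpty, Nat.le_zero, Set.ncard_eq_zero, Set.eq_empty_iff_forall_notMem]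
    intro a ha
    rcases hya : y a with a' | b
    · refine ha ?_
      have h1 := hf a ⟨a', hya⟩
      rw [sumHom_inl]
      simp only [coe_trans, Function.comp_apply, subtypeUnivEquiv_apply, hg a ⟨a', hya⟩, ← h1]
      simp [y]
    · exact hB0.elim b
  · refine le_trans ?_ (hB Set.univ)
    refine Set.ncard_le_ncard_of_injOn (fun a => (y a).elim (fun _ => b₀) id)
      (fun _ _ => Set.mem_univ _) ?_
    have key : ∀ a, x (e.symm (.inl a)) ≠ sumHom e (g.trans
        (subtypeUnivEquiv Finset.mem_univ), 1) (e.symm (.inl a)) → ∃ b, y a = .inr b := by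
      intro a ha
      rcases hya : y a with a' | b
      · refine absurd ?_ ha
        have h1 := hf a ⟨a', hya⟩
        rw [sumHom_inl]
        simp only [coe_trans, Function.comp_apply, subtypeUnivEquiv_apply, hg a ⟨a', hya⟩, ← h1]
        simp [y]
      · exact ⟨b, rfl⟩
    intro a ha a' ha' h
    obtain ⟨b, hb⟩ := key a ha
    obtain ⟨b', hb'⟩ := key a' ha'
    simp only [hb, hb', Sum.elim_inr, id] at h
    exact hy (by rw [hb, hb', h])

theorem stabCount_conj (ρ : H →* Perm X) (u : Perm X) (K : Subgroup H) :
    stabCount ((MulAut.conj u).toMonoidHom.comp ρ) K = stabCount ρ K := by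
  rw [stabCount, ncard_setOf_eq_of_equiv u.symm]
  simp [stabCount, SetLike.ext_iff]

variable [Finite X]

theorem sum_stabCount [Fintype (Subgroup H)] (ρ : H →* Perm X) :
    ∑ K, stabCount ρ K = Nat.card X := by
  rw [← Nat.card_congr (sigmaFiberEquiv (stab ρ)), Nat.card_sigma]
  rfl

theorem diffCount_triangle (a b c : Perm X) :
    diffCount a c ≤ diffCount a b + diffCount b c := by
  refine (Set.ncard_le_ncard ?_).trans (Set.ncard_union_le _ _)
  intro x hx
  by_contra hcon
  simp only [Set.mem_union, Set.mem_ofPred_eq, not_or, not_not] at hcon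
  exact hx (hcon.1.trans hcon.2)

theorem diffCount_le (a b : Perm X) : diffCount a b ≤ Nat.card X := by
  rw [← Set.ncard_univ]
  exact Set.ncard_le_ncard (Set.subset_univ _)

theorem ncard_not_agree_le [Fintype H] (ρ ρ' : H →* Perm X) :
    {x | ¬ ∀ h, ρ h x = ρ' h x}.ncard ≤ ∑ h, diffCount (ρ h) (ρ' h) := by
  refine le_trans (Set.ncard_le_ncard ?_) (Set.ncard_iUnion_le_of_fintype _)
  intro x hx
  simpa using hx

theorem stabCount_le [Fintype H] (ρ ρ' : H →* Perm X) (K : Subgroup H) :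
    stabCount ρ K ≤ stabCount ρ' K + ∑ h, diffCount (ρ h) (ρ' h) := by
  refine le_trans (le_trans (Set.ncard_le_ncard ?_) (Set.ncard_union_le
    {x | stab ρ' x = K} {x | ¬ ∀ h, ρ h x = ρ' h x})) (Nat.add_le_add_left
      (ncard_not_agree_le ρ ρ') _)
  intro x hx
  by_cases h : ∀ h, ρ h x = ρ' h x
  · refine Or.inl ?_
    rw [Set.mem_ofPred_eq, ← hx]
    ext k
    simp [h]
  · exact Or.inr h

/-- A partial isomorphism of permutation representations with equally many points of each
stabilizer extends to an isomorphism. -/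
theorem exists_extend_equivariant (ρ ρ' : H →* Perm X)
    (hcount : ∀ K, stabCount ρ K = stabCount ρ' K) (U : Set X) (f : X → X) (hf : Set.InjOn f U)
    (hU : ∀ h, ∀ x ∈ U, ρ h x ∈ U) (hfU : ∀ h, ∀ x ∈ U, f (ρ h x) = ρ' h (f x)) :
    ∃ σ : Perm X, (∀ x ∈ U, σ x = f x) ∧ ∀ h x, σ (ρ h x) = ρ' h (σ x) := by
  classical
  induction hn : Uᶜ.ncard using Nat.strong_induction_on generalizing U f with
  | _ n ih =>
  have hUiff : ∀ h x, ρ h x ∈ U ↔ x ∈ U := fun h x =>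
    ⟨fun hx => by simpa using hU h⁻¹ _ hx, hU h x⟩
  by_cases hUtop : U = Set.univ
  · subst hUtop
    have hbij : Function.Bijective f := Finite.injective_iff_bijective.1 (Set.injOn_univ.1 hf)
    exact ⟨ofBijective f hbij, fun x _ => rfl, fun h x => hfU h x trivial⟩
  obtain ⟨z, hz⟩ : ∃ z, z ∉ U := by
    by_contra hcon
    push Not at hcon
    exact hUtop (Set.eq_univ_of_forall hcon)
  have hinj : ∀ x ∈ U, stab ρ' (f x) = stab ρ x := fun x hx => by
    ext h
    rw [mem_stab, mem_stab, ← hfU h x hx]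
    exact ⟨fun h' => hf (hU h x hx) hx h', fun h' => by rw [h']⟩
  obtain ⟨z', hz', hz'U⟩ : ∃ z', stab ρ' z' = stab ρ z ∧ z' ∉ f '' U := by
    by_contra hcon
    push Not at hcon
    have h1 : {x | stab ρ' x = stab ρ z} ⊆ f '' ({x | stab ρ x = stab ρ z} \ {z}) := by
      intro y hy
      obtain ⟨x, hx, rfl⟩ := hcon y hy
      refine ⟨x, ⟨?_, fun h => hz (h ▸ hx)⟩, rfl⟩
      rw [Set.mem_ofPred_eq, ← hinj x hx]
      exact hy
    have h2 := (Set.ncard_le_ncard h1).trans (Set.ncard_image_le)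
    have h3 := Set.ncard_sdiff_singleton_lt_of_mem (s := {x | stab ρ x = stab ρ z}) (a := z) rfl
    have h4 := hcount (stab ρ z)
    simp only [stabCount] at h4
    omega
  have hwd : ∀ h k, ρ h z = ρ k z ↔ ρ' h z' = ρ' k z' := fun h k => by
    have key : ∀ {ρ : H →* Perm X} {w : X}, ρ h w = ρ k w ↔ k⁻¹ * h ∈ stab ρ w := by
      intro ρ w
      rw [mem_stab, map_mul, map_inv, Perm.mul_apply, Perm.inv_eq_iff_eq]
    rw [key, key, hz']
  let f' : X → X := fun x => if hx : ∃ h, ρ h z = x then ρ' hx.choose z' else f x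
  have hf'z : ∀ h, f' (ρ h z) = ρ' h z' := fun h => by
    have hx : ∃ k, ρ k z = ρ h z := ⟨h, rfl⟩
    simp only [f', dif_pos hx]
    exact (hwd _ _).1 hx.choose_spec
  have hf'U : ∀ x ∈ U, f' x = f x := fun x hx => by
    refine dif_neg ?_
    rintro ⟨h, rfl⟩
    exact hz ((hUiff h z).1 hx)
  have hne : ∀ x ∈ U, ∀ h, f x ≠ ρ' h z' := fun x hx h heq => by
    refine hz'U ⟨ρ h⁻¹ x, hU _ _ hx, ?_⟩
    rw [hfU _ _ hx, heq]
    simp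
  obtain ⟨σ, hσ, hσ'⟩ := ih ((U ∪ Set.range fun h => ρ h z)ᶜ).ncard (by
      rw [← hn]
      refine Set.ncard_lt_ncard ⟨Set.compl_subset_compl.2 Set.subset_union_left, fun h => ?_⟩
      exact h (show z ∈ Uᶜ from hz) (Or.inr ⟨1, by simp⟩))
    (U ∪ Set.range fun h => ρ h z) f' (by
      rintro x (hx | ⟨h, rfl⟩) y (hy | ⟨k, rfl⟩) hxy
      · rw [hf'U x hx, hf'U y hy] at hxy
        exact hf hx hy hxy
      · simp only [hf'z, hf'U x hx] at hxy
        exact absurd hxy (hne x hx k)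
      · simp only [hf'z, hf'U y hy] at hxy
        exact absurd hxy.symm (hne y hy h)
      · simp only [hf'z] at hxy
        exact (hwd h k).2 hxy)
    (by
      rintro k x (hx | ⟨h, rfl⟩)
      · exact Or.inl (hU k x hx)
      · exact Or.inr ⟨k * h, by simp⟩)
    (by
      rintro k x (hx | ⟨h, rfl⟩)
      · rw [hf'U x hx, hf'U _ (hU k x hx), hfU k x hx]
      · have h1 : ρ k (ρ h z) = ρ (k * h) z := by simp
        simp only [h1, hf'z]
        simp) rfl
  exact ⟨σ, fun x hx => (hσ x (Or.inl hx)).trans (hf'U x hx), hσ'⟩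

theorem exists_conj_of_stabCount_eq [Fintype H] (ρ ρ' : H →* Perm X)
    (hcount : ∀ K, stabCount ρ K = stabCount ρ' K) :
    ∃ u : Perm X, (∀ h, u * ρ h * u⁻¹ = ρ' h) ∧
      diffCount u 1 ≤ ∑ h, diffCount (ρ h) (ρ' h) := by
  obtain ⟨u, hu, hu'⟩ := exists_extend_equivariant ρ ρ' hcount {x | ∀ h, ρ h x = ρ' h x} id
    Function.injective_id.injOn
    (fun h x hx k => by
      have h1 := hx (k * h)
      rw [map_mul, map_mul, Perm.mul_apply, Perm.mul_apply] at h1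
      rw [h1, hx h]) (fun h x hx => hx h)
  refine ⟨u, fun h => ?_, le_trans (Set.ncard_le_ncard ?_) (ncard_not_agree_le ρ ρ')⟩
  · rw [mul_inv_eq_iff_eq_mul]
    ext x
    exact hu' h x
  · intro x hx hx'
    exact hx (hu x hx')

theorem exists_equiv_sum_of_le (X : FinSet) (k : ℕ) (hk : k ≤ Nat.card X.carrier) :
    ∃ (A B : FinSet) (_ : X.carrier ≃ A.carrier ⊕ B.carrier), Nat.card A.carrier = k := by
  classical
  obtain ⟨s, -, hs⟩ := Set.exists_subset_card_eq (s := (Set.univ : Set X.carrier)) (n := k)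
    (by rwa [Set.ncard_univ])
  exact ⟨⟨s⟩, ⟨(sᶜ : Set X.carrier)⟩, (Set.sumCompl s).symm, hs⟩

end PermSystem

open PermSystem in
/-- Permutation groups with the number of displaced points as gap, and with the numbers of points
of given stabilizer as multiplicities. -/
def permMultiplicitySystem (H : Type*) [Group H] :
    MultiplicitySystem FinSet.Aut H (Subgroup H) where
  size X := Nat.card X.carrier
  gap σ τ := diffCount σ τ
  mult ρ := stabCount ρ

open PermSystem in
theorem isSplitting_sumHom (H : Type*) [Group H] {X A B : FinSet}
    (e : X.carrier ≃ A.carrier ⊕ B.carrier) :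
    (permMultiplicitySystem H).IsSplitting (X := X) (A := A) (B := B) (sumHom e) where
  injective := sumHom_injective e
  size_eq := (Nat.card_congr e).trans Nat.card_sum
  gap_eq a a' b b' :=
    (congrArg Nat.cast (diffCount_sumHom e a a' b b')).trans (Nat.cast_add _ _)
  mult_eq ρ ρ' K := stabCount_sumHom e ρ ρ' K
  near x := by
    obtain ⟨a, ha⟩ := exists_diffCount_sumHom_le e x
    refine ⟨a, ?_⟩
    have h1 : (diffCount x (sumHom e (a, 1)) : ℝ) ≤ 2 * Nat.card B.carrier := by
      exact_mod_cast ha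
    have h2 : (0 : ℝ) ≤ Nat.card B.carrier := Nat.cast_nonneg _
    exact h1.trans (by change _ ≤ 8 * (Nat.card B.carrier : ℝ); linarith)

open PermSystem in
open scoped Pointwise in
/-- The surgery system of permutation groups, in which the types are the stabilizers. -/
def permSystem (H : Type*) [Group H] [Fintype H] [Fintype (Subgroup H)] :
    SurgerySystem FinSet.Aut H (Subgroup H) where
  size X := Nat.card X.carrier
  gap σ τ := diffCount σ τ
  mult ρ := stabCount ρ
  gap_nonneg _ _ := Nat.cast_nonneg _
  gap_self a := by simp [diffCount]
  gap_comm a b := by simp only [diffCount, ne_comm]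
  gap_triangle a b c := by
    have : (diffCount a c : ℝ) ≤ diffCount a b + diffCount b c := by
      exact_mod_cast diffCount_triangle a b c
    have h1 : (0 : ℝ) ≤ diffCount a b := Nat.cast_nonneg _
    have h2 : (0 : ℝ) ≤ diffCount b c := Nat.cast_nonneg _
    linarith
  gap_mul_left c a b := by simp [diffCount]
  gap_mul_right c a b := by
    rw [diffCount, ncard_setOf_eq_of_equiv c]
    simp [diffCount]
  gap_le {X} a b := by
    have : (diffCount a b : ℝ) ≤ Nat.card X.carrier := by exact_mod_cast diffCount_le a b
    linarith [(Nat.cast_nonneg _ : (0 : ℝ) ≤ Nat.card X.carrier)]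
  sum_mult ρ := sum_stabCount ρ
  mult_comp ρ α K := by
    refine congrArg Set.ncard (Set.ext fun x => ?_)
    rw [Set.mem_ofPred_eq, Set.mem_ofPred_eq, eq_comm, ← inv_smul_eq_iff, eq_comm]
    congr! 1
    ext h
    rw [Subgroup.mem_inv_pointwise_smul_iff]
    rfl
  mult_conj ρ u K := stabCount_conj ρ u K
  mult_sub_le ρ ρ' K := by
    rw [sub_le_iff_le_add']
    exact_mod_cast stabCount_le ρ ρ' K
  triv := ⊤
  smul_triv α := by
    ext h
    simp [Subgroup.mem_pointwise_smul_iff_inv_smul_mem]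
  mult_one K hK := by
    rw [stabCount, Set.ncard_eq_zero, Set.eq_empty_iff_forall_notMem]
    intro x hx
    refine hK (hx.symm.trans ?_)
    ext h
    simp
  exists_splitting_size X k hk := by
    obtain ⟨A, B, e, hA⟩ := exists_equiv_sum_of_le X k hk
    exact ⟨A, B, sumHom e, isSplitting_sumHom H (A := A) (B := B) e, hA⟩
  exists_splitting_mult {X} ρ O := by
    classical
    let p : X.carrier → Prop := fun x => stab ρ x ∈ O
    let e : X.carrier ≃ {x // p x} ⊕ {x // ¬ p x} := (Equiv.sumCompl p).symm
    refine ⟨⟨{x // p x}⟩, ⟨{x // ¬ p x}⟩, sumHom e,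
      isSplitting_sumHom H (A := ⟨{x // p x}⟩) (B := ⟨{x // ¬ p x}⟩) e, fun α a ha hO => ?_,
      fun ρA ρB hρ => ⟨fun K hK => ?_, fun K hK => ?_⟩⟩
    · have hp : ∀ x, p (a x) ↔ p x := fun x => by
        have : stab ρ (a x) = α • stab ρ x := by
          ext h
          rw [Subgroup.mem_pointwise_smul_iff_inv_smul_mem]
          have h1 := ha (α⁻¹ h)
          rw [← MulAut.mul_apply, mul_inv_cancel, MulAut.one_apply] at h1
          rw [mem_stab, h1]
          simp
        simp only [p, this, hO]
      refine ⟨(a.subtypePerm hp, a.subtypePerm fun x => not_congr (hp x)), ?_⟩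
      ext x
      obtain ⟨y, rfl⟩ := e.symm.surjective x
      rcases y with y | y
      · rw [sumHom_inl]; rfl
      · rw [sumHom_inr]; rfl
    · rw [stabCount, Set.ncard_eq_zero, Set.eq_empty_iff_forall_notMem]
      intro x (hx : stab ρA x = K)
      rw [← hx] at hK
      refine hK ?_
      have : stab ρA x = stab ρ (e.symm (.inl x)) := by
        ext h
        have hh : ρ h = sumHom e (ρA h, ρB h) := (DFunLike.congr_fun hρ h).symm
        rw [mem_stab, mem_stab, hh, sumHom_inl]
        simp
      rw [this]
      exact x.2
    · rw [stabCount, Set.ncard_eq_zero, Set.eq_empty_iff_forall_notMem]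
      intro x (hx : stab ρB x = K)
      rw [← hx] at hK
      have : stab ρB x = stab ρ (e.symm (.inr x)) := by
        ext h
        have hh : ρ h = sumHom e (ρA h, ρB h) := (DFunLike.congr_fun hρ h).symm
        rw [mem_stab, mem_stab, hh, sumHom_inr]
        simp
      rw [this] at hK
      exact x.2 hK
  exists_transport {X Y} h := by
    obtain ⟨e⟩ : Nonempty (X.carrier ≃ Y.carrier) := Finite.card_eq.1 h
    refine ⟨e.permCongrHom.toMonoidHom, fun ρ K => ?_⟩
    change stabCount (e.permCongrHom.toMonoidHom.comp ρ) K = stabCount ρ K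
    rw [stabCount, ncard_setOf_eq_of_equiv e.symm]
    simp [stabCount, SetLike.ext_iff, Equiv.permCongrHom]
  exists_conj ρ ρ' h := by
    obtain ⟨u, hu, hu'⟩ := exists_conj_of_stabCount_eq ρ ρ' h
    refine ⟨u, hu, ?_⟩
    have h1 : (diffCount u 1 : ℝ) ≤ ∑ h, (diffCount (ρ h) (ρ' h) : ℝ) := by exact_mod_cast hu'
    have h2 : 0 ≤ ∑ h, (diffCount (ρ h) (ρ' h) : ℝ) :=
      Finset.sum_nonneg fun _ _ => Nat.cast_nonneg _
    linarith

namespace HilbertSum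

variable {V W A B : Type*} [NormedAddCommGroup V] [InnerProductSpace ℂ V]
  [NormedAddCommGroup W] [InnerProductSpace ℂ W]
  [NormedAddCommGroup A] [InnerProductSpace ℂ A] [NormedAddCommGroup B] [InnerProductSpace ℂ B]
  (e : V ≃ₗᵢ[ℂ] WithLp 2 (A × B))

/-- The inclusion of the first summand of an orthogonal sum. -/
def inl : A →ₗ[ℂ] V :=
  e.symm.toLinearEquiv.toLinearMap ∘ₗ (WithLp.linearEquiv 2 ℂ (A × B)).symm.toLinearMap ∘ₗ
    LinearMap.inl ℂ A B

/-- The inclusion of the second summand of an orthogonal sum. -/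
def inr : B →ₗ[ℂ] V :=
  e.symm.toLinearEquiv.toLinearMap ∘ₗ (WithLp.linearEquiv 2 ℂ (A × B)).symm.toLinearMap ∘ₗ
    LinearMap.inr ℂ A B

theorem inl_apply (x : A) : inl e x = e.symm (WithLp.toLp 2 (x, 0)) := rfl

theorem inr_apply (x : B) : inr e x = e.symm (WithLp.toLp 2 (0, x)) := rfl

@[simp]
theorem norm_inl (x : A) : ‖inl e x‖ = ‖x‖ := by
  simp [inl_apply]

@[simp]
theorem norm_inr (x : B) : ‖inr e x‖ = ‖x‖ := by
  simp [inr_apply]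

theorem inl_injective : Function.Injective (inl e) :=
  (injective_iff_map_eq_zero _).2 fun x hx => by rw [← norm_eq_zero, ← norm_inl e, hx, norm_zero]

theorem inr_injective : Function.Injective (inr e) :=
  (injective_iff_map_eq_zero _).2 fun x hx => by rw [← norm_eq_zero, ← norm_inr e, hx, norm_zero]

theorem inl_add_inr (x : A) (y : B) : inl e x + inr e y = e.symm (WithLp.toLp 2 (x, y)) := by
  rw [inl_apply, inr_apply, ← map_add, ← WithLp.toLp_add]
  simp

theorem inl_fst_add_inr_snd (v : V) : inl e (e v).fst + inr e (e v).snd = v := by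
  rw [inl_add_inr]
  exact e.symm_apply_apply v

theorem inl_add_inr_eq_iff {x x' : A} {y y' : B} :
    inl e x + inr e y = inl e x' + inr e y' ↔ x = x' ∧ y = y' := by
  simp [inl_add_inr]

/-- The pairs of unitaries on the summands of an orthogonal sum as unitaries on the sum. -/
def sumHom : (A ≃ₗᵢ[ℂ] A) × (B ≃ₗᵢ[ℂ] B) →* (V ≃ₗᵢ[ℂ] V) where
  toFun ab := (e.trans (LinearIsometryEquiv.withLpProdCongr 2 ab.1 ab.2)).trans e.symm
  map_one' := by
    ext v
    exact e.symm_apply_apply v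
  map_mul' ab ab' := by
    ext v
    simp

@[simp]
theorem sumHom_inl (a : A ≃ₗᵢ[ℂ] A) (b : B ≃ₗᵢ[ℂ] B) (x : A) :
    sumHom e (a, b) (inl e x) = inl e (a x) := by
  simp [sumHom, inl_apply]

@[simp]
theorem sumHom_inr (a : A ≃ₗᵢ[ℂ] A) (b : B ≃ₗᵢ[ℂ] B) (x : B) :
    sumHom e (a, b) (inr e x) = inr e (b x) := by
  simp [sumHom, inr_apply]

theorem sumHom_injective : Function.Injective (sumHom e) := by
  rintro ⟨a, b⟩ ⟨a', b'⟩ h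
  ext x
  · apply inl_injective e
    rw [← sumHom_inl e a b, h, sumHom_inl]
  · apply inr_injective e
    rw [← sumHom_inr e a b, h, sumHom_inr]

end HilbertSum

namespace HilbertSchmidt

theorem norm_sub_apply_le {V : Type*} [NormedAddCommGroup V] [InnerProductSpace ℂ V]
    (a b : V ≃ₗᵢ[ℂ] V) (x : V) :
    ‖(a.toLinearEquiv.toLinearMap - b.toLinearEquiv.toLinearMap) x‖ ≤ 2 * ‖x‖ := by
  refine (norm_sub_le _ _).trans_eq ?_
  simp [two_mul]

variable {V W A B : Type*} [NormedAddCommGroup V] [InnerProductSpace ℂ V] [FiniteDimensional ℂ V]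
  [NormedAddCommGroup W] [InnerProductSpace ℂ W] [FiniteDimensional ℂ W]
  [NormedAddCommGroup A] [InnerProductSpace ℂ A] [FiniteDimensional ℂ A]
  [NormedAddCommGroup B] [InnerProductSpace ℂ B] [FiniteDimensional ℂ B]

/-- The square of the Hilbert-Schmidt norm, without normalization. -/
def normSq (M : V →ₗ[ℂ] W) : ℝ := (LinearMap.trace ℂ V (LinearMap.adjoint M ∘ₗ M)).re

theorem normSq_eq_sum {ι : Type*} [Fintype ι] (M : V →ₗ[ℂ] W) (b : OrthonormalBasis ι ℂ V) :
    normSq M = ∑ i, ‖M (b i)‖ ^ 2 := by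
  rw [normSq, LinearMap.trace_eq_sum_inner _ b, Complex.re_sum]
  refine Finset.sum_congr rfl fun i _ => ?_
  rw [LinearMap.comp_apply, LinearMap.adjoint_inner_right, inner_self_eq_norm_sq_to_K]
  norm_cast

theorem normSq_nonneg (M : V →ₗ[ℂ] W) : 0 ≤ normSq M := by
  rw [normSq_eq_sum M (stdOrthonormalBasis ℂ V)]
  positivity

@[simp]
theorem normSq_zero : normSq (0 : V →ₗ[ℂ] W) = 0 := by
  simp [normSq]

theorem normSq_neg (M : V →ₗ[ℂ] W) : normSq (-M) = normSq M := by
  simp [normSq_eq_sum _ (stdOrthonormalBasis ℂ V)]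

theorem normSq_sub_comm (M N : V →ₗ[ℂ] W) : normSq (M - N) = normSq (N - M) := by
  rw [← normSq_neg, neg_sub]

theorem normSq_sum_le {α : Type*} (s : Finset α) (M : α → V →ₗ[ℂ] W) :
    normSq (∑ a ∈ s, M a) ≤ s.card * ∑ a ∈ s, normSq (M a) := by
  simp only [normSq_eq_sum _ (stdOrthonormalBasis ℂ V)]
  rw [Finset.sum_comm, Finset.mul_sum]
  refine Finset.sum_le_sum fun i _ => ?_
  rw [LinearMap.sum_apply]
  calc _ ≤ (∑ a ∈ s, ‖M a (stdOrthonormalBasis ℂ V i)‖) ^ 2 := by gcongr; exact norm_sum_le _ _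
    _ ≤ _ := sq_sum_le_card_mul_sum_sq

theorem normSq_add_le (M N : V →ₗ[ℂ] W) : normSq (M + N) ≤ 2 * (normSq M + normSq N) := by
  simpa using normSq_sum_le Finset.univ ![M, N]

theorem normSq_smul (c : ℂ) (M : V →ₗ[ℂ] W) : normSq (c • M) = ‖c‖ ^ 2 * normSq M := by
  simp [normSq_eq_sum _ (stdOrthonormalBasis ℂ V), norm_smul, mul_pow, Finset.mul_sum]

theorem normSq_comp_left (U : W →ₗ[ℂ] A) (hU : ∀ x, ‖U x‖ = ‖x‖) (M : V →ₗ[ℂ] W) :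
    normSq (U ∘ₗ M) = normSq M := by
  simp [normSq_eq_sum _ (stdOrthonormalBasis ℂ V), hU]

theorem normSq_comp_right (U : V ≃ₗᵢ[ℂ] W) (M : W →ₗ[ℂ] A) :
    normSq (M ∘ₗ U.toLinearEquiv.toLinearMap) = normSq M := by
  rw [normSq_eq_sum _ (stdOrthonormalBasis ℂ V),
    normSq_eq_sum M ((stdOrthonormalBasis ℂ V).map U)]
  simp

theorem normSq_le_mul_finrank (M : V →ₗ[ℂ] W) {c : ℝ} (hM : ∀ x, ‖M x‖ ≤ c * ‖x‖) :
    normSq M ≤ c ^ 2 * Module.finrank ℂ V := by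
  rw [normSq_eq_sum _ (stdOrthonormalBasis ℂ V)]
  refine (Finset.sum_le_card_nsmul _ _ (c ^ 2) fun i _ => ?_).trans ?_
  · have := hM (stdOrthonormalBasis ℂ V i)
    rw [OrthonormalBasis.norm_eq_one, mul_one] at this
    gcongr
  · simp [mul_comm]

theorem normSq_of_isometry (M : V →ₗ[ℂ] W) (hM : ∀ x, ‖M x‖ = ‖x‖) :
    normSq M = Module.finrank ℂ V := by
  simp [normSq_eq_sum _ (stdOrthonormalBasis ℂ V), hM]

theorem normSq_eq_add (e : V ≃ₗᵢ[ℂ] WithLp 2 (A × B)) (M : V →ₗ[ℂ] W) :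
    normSq M = normSq (M ∘ₗ HilbertSum.inl e) + normSq (M ∘ₗ HilbertSum.inr e) := by
  rw [normSq_eq_sum M (((stdOrthonormalBasis ℂ A).prod (stdOrthonormalBasis ℂ B)).map e.symm),
    normSq_eq_sum _ (stdOrthonormalBasis ℂ A), normSq_eq_sum _ (stdOrthonormalBasis ℂ B),
    Fintype.sum_sum_type]
  simp [HilbertSum.inl_apply, HilbertSum.inr_apply]

theorem inl_orthogonalDecomposition (U : Submodule ℂ V) (x : U) :
    HilbertSum.inl U.orthogonalDecomposition x = x := by
  simp [HilbertSum.inl_apply]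

theorem inr_orthogonalDecomposition (U : Submodule ℂ V) (x : Uᗮ) :
    HilbertSum.inr U.orthogonalDecomposition x = x := by
  simp [HilbertSum.inr_apply]

theorem normSq_le_of_vanish (M : V →ₗ[ℂ] W) {c : ℝ} (hM : ∀ x, ‖M x‖ ≤ c * ‖x‖)
    (U : Submodule ℂ V) (hU : ∀ x ∈ U, M x = 0) : normSq M ≤ c ^ 2 * Module.finrank ℂ Uᗮ := by
  rw [normSq_eq_add U.orthogonalDecomposition]
  have h1 : M ∘ₗ HilbertSum.inl U.orthogonalDecomposition = 0 := by
    ext x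
    simp [inl_orthogonalDecomposition, hU]
  rw [h1, normSq_zero, zero_add]
  refine normSq_le_mul_finrank _ fun x => ?_
  refine (hM _).trans_eq ?_
  rw [HilbertSum.norm_inr]

theorem finrank_le_normSq (M : V →ₗ[ℂ] W) (U : Submodule ℂ V) (hU : ∀ x ∈ U, ‖M x‖ = ‖x‖) :
    Module.finrank ℂ U ≤ normSq M := by
  rw [normSq_eq_add U.orthogonalDecomposition, normSq_of_isometry (_ ∘ₗ _)]
  · exact le_add_of_nonneg_right (normSq_nonneg _)
  · intro x
    rw [LinearMap.comp_apply, inl_orthogonalDecomposition, hU x x.2]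
    rfl

/-- The squared Hilbert-Schmidt distance of two unitaries, without normalization. -/
def gap (a b : V ≃ₗᵢ[ℂ] V) : ℝ :=
  normSq (a.toLinearEquiv.toLinearMap - b.toLinearEquiv.toLinearMap)

theorem gap_nonneg (a b : V ≃ₗᵢ[ℂ] V) : 0 ≤ gap a b := normSq_nonneg _

theorem gap_le (a b : V ≃ₗᵢ[ℂ] V) : gap a b ≤ 4 * Module.finrank ℂ V :=
  (normSq_le_mul_finrank _ (norm_sub_apply_le a b)).trans_eq (by norm_num)

theorem gap_comm (a b : V ≃ₗᵢ[ℂ] V) : gap a b = gap b a := normSq_sub_comm _ _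

theorem gap_triangle (a b c : V ≃ₗᵢ[ℂ] V) : gap a c ≤ 2 * (gap a b + gap b c) := by
  rw [gap, ← sub_add_sub_cancel _ b.toLinearEquiv.toLinearMap]
  exact normSq_add_le _ _

theorem gap_mul_left (c a b : V ≃ₗᵢ[ℂ] V) : gap (c * a) (c * b) = gap a b := by
  rw [gap, gap, ← normSq_comp_left c.toLinearEquiv.toLinearMap (fun x => c.norm_map x)
    (a.toLinearEquiv.toLinearMap - _), LinearMap.comp_sub]
  rfl

theorem gap_mul_right (c a b : V ≃ₗᵢ[ℂ] V) : gap (a * c) (b * c) = gap a b := by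
  rw [gap, gap, ← normSq_comp_right c (a.toLinearEquiv.toLinearMap - _), LinearMap.sub_comp]
  rfl

theorem gap_sumHom (e : V ≃ₗᵢ[ℂ] WithLp 2 (A × B)) (a a' : A ≃ₗᵢ[ℂ] A) (b b' : B ≃ₗᵢ[ℂ] B) :
    gap (HilbertSum.sumHom e (a, b)) (HilbertSum.sumHom e (a', b')) = gap a a' + gap b b' := by
  rw [gap, normSq_eq_add e, gap, gap, ← normSq_comp_left (HilbertSum.inl e) (by simp)
    (a.toLinearEquiv.toLinearMap - _), ← normSq_comp_left (HilbertSum.inr e) (by simp)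
    (b.toLinearEquiv.toLinearMap - _)]
  congr 2 <;> ext x <;> simp

theorem exists_gap_sumHom_le (e : V ≃ₗᵢ[ℂ] WithLp 2 (A × B)) (x : V ≃ₗᵢ[ℂ] V) :
    ∃ a : A ≃ₗᵢ[ℂ] A, gap x (HilbertSum.sumHom e (a, 1)) ≤ 8 * Module.finrank ℂ B := by
  let F : A →ₗ[ℂ] WithLp 2 (A × B) :=
    e.toLinearEquiv.toLinearMap ∘ₗ x.toLinearEquiv.toLinearMap ∘ₗ HilbertSum.inl e
  have hF : ∀ y, F y = e (x (HilbertSum.inl e y)) := fun _ => rfl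
  let P : A →ₗ[ℂ] B := LinearMap.snd ℂ A B ∘ₗ (WithLp.linearEquiv 2 ℂ (A × B)).toLinearMap ∘ₗ F
  let Q : A →ₗ[ℂ] A := LinearMap.fst ℂ A B ∘ₗ (WithLp.linearEquiv 2 ℂ (A × B)).toLinearMap ∘ₗ F
  let U := LinearMap.ker P
  have hU : ∀ y ∈ U, x (HilbertSum.inl e y) = HilbertSum.inl e (Q y) := fun y hy => by
    rw [← e.injective.eq_iff, HilbertSum.inl_apply e (Q y), e.apply_symm_apply]
    refine (WithLp.equiv 2 (A × B)).injective (Prod.ext rfl ?_)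
    exact hy
  let R : U →ₗᵢ[ℂ] A :=
    { toLinearMap := Q ∘ₗ U.subtype
      norm_map' := fun y => by
        rw [LinearMap.comp_apply, ← HilbertSum.norm_inl e, Submodule.subtype_apply, ← hU y y.2]
        simp }
  let a : A ≃ₗᵢ[ℂ] A := R.extend.toLinearIsometryEquiv rfl
  refine ⟨a, ?_⟩
  have hdim : Module.finrank ℂ Uᗮ ≤ Module.finrank ℂ B := by
    have h1 := Submodule.finrank_add_finrank_orthogonal U
    have h2 := LinearMap.finrank_range_add_finrank_ker P
    have h3 := Submodule.finrank_le (LinearMap.range P)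
    change _ + Module.finrank ℂ U = _ at h2
    omega
  have hdim' : (Module.finrank ℂ Uᗮ : ℝ) ≤ Module.finrank ℂ B := by exact_mod_cast hdim
  rw [gap, normSq_eq_add e]
  have h1 := normSq_le_of_vanish (c := 2) ((x.toLinearEquiv.toLinearMap -
      (HilbertSum.sumHom e (a, 1)).toLinearEquiv.toLinearMap) ∘ₗ HilbertSum.inl e)
    (fun y => (norm_sub_apply_le _ _ _).trans_eq (by rw [HilbertSum.norm_inl])) U (fun y hy => by
      have h2 : a y = Q y := R.extend_apply ⟨y, hy⟩
      simp [h2, hU y hy])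
  have h2 := normSq_le_mul_finrank (c := 2) ((x.toLinearEquiv.toLinearMap -
      (HilbertSum.sumHom e (a, 1)).toLinearEquiv.toLinearMap) ∘ₗ HilbertSum.inr e)
    (fun y => (norm_sub_apply_le _ _ _).trans_eq (by rw [HilbertSum.norm_inr]))
  linarith

end HilbertSchmidt

/-- Finite-dimensional spaces have subspaces of all smaller dimensions. -/
theorem Submodule.exists_finrank_eq_of_le {V : Type*} [AddCommGroup V] [Module ℂ V]
    [FiniteDimensional ℂ V] {k : ℕ} (hk : k ≤ Module.finrank ℂ V) :
    ∃ U : Submodule ℂ V, Module.finrank ℂ U = k := by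
  have h := (Module.finBasis ℂ V).linearIndependent.comp (Fin.castLE hk) (Fin.castLE_injective hk)
  exact ⟨Submodule.span ℂ _, (finrank_span_eq_card h).trans (Fintype.card_fin k)⟩

namespace UnitaryRep

open Module.End

variable {H : Type*} [Group H]
  {V W A B : Type*} [NormedAddCommGroup V] [InnerProductSpace ℂ V] [NormedAddCommGroup W]
  [InnerProductSpace ℂ W] [NormedAddCommGroup A] [InnerProductSpace ℂ A]
  [NormedAddCommGroup B] [InnerProductSpace ℂ B]

/-- The linear representation underlying a unitary representation. -/
def toRep (ρ : H →* (V ≃ₗᵢ[ℂ] V)) : H →* Module.End ℂ V where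
  toFun h := (ρ h).toLinearEquiv.toLinearMap
  map_one' := by ext; simp
  map_mul' _ _ := by ext; simp

@[simp]
theorem toRep_apply (ρ : H →* (V ≃ₗᵢ[ℂ] V)) (h : H) (v : V) : toRep ρ h v = ρ h v := rfl

theorem inner_apply_left (ρ : H →* (V ≃ₗᵢ[ℂ] V)) (h : H) (v w : V) :
    inner ℂ (ρ h v) w = inner ℂ v (ρ h⁻¹ w) := by
  rw [← (ρ h⁻¹).inner_map_map]
  simp

theorem trace_toRep_conj (ρ : H →* (V ≃ₗᵢ[ℂ] V)) (k h : H) :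
    LinearMap.trace ℂ V (toRep ρ (k * h * k⁻¹)) = LinearMap.trace ℂ V (toRep ρ h) := by
  rw [map_mul, LinearMap.trace_mul_comm, ← map_mul, inv_mul_cancel_left]

variable [Fintype H]

/-- The elements of the center of the group algebra that act as symmetric operators and separate
the classes of `H`. -/
def classElem (h : H) : MonoidAlgebra ℂ H :=
  ∑ k : H, (MonoidAlgebra.single (k * h * k⁻¹) (1 + Complex.I) +
    MonoidAlgebra.single (k * h⁻¹ * k⁻¹) (1 - Complex.I))

/-- The symmetric operators given by central elements of the group algebra. -/
def classOp (ρ : H →* (V ≃ₗᵢ[ℂ] V)) (h : H) : V →ₗ[ℂ] V :=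
  MonoidAlgebra.lift ℂ (Module.End ℂ V) H (toRep ρ) (classElem h)

theorem classOp_eq (ρ : H →* (V ≃ₗᵢ[ℂ] V)) (h : H) :
    classOp ρ h = ∑ k : H, ((1 + Complex.I) • toRep ρ (k * h * k⁻¹) +
      (1 - Complex.I) • toRep ρ (k * h⁻¹ * k⁻¹)) := by
  simp only [classOp, classElem, map_sum, map_add, MonoidAlgebra.lift_single]

theorem classOp_apply (ρ : H →* (V ≃ₗᵢ[ℂ] V)) (h : H) (v : V) :
    classOp ρ h v = ∑ k : H, ((1 + Complex.I) • ρ (k * h * k⁻¹) v +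
      (1 - Complex.I) • ρ (k * h⁻¹ * k⁻¹) v) := by
  rw [classOp_eq, LinearMap.sum_apply]
  rfl

theorem classOp_conj (ρ : H →* (V ≃ₗᵢ[ℂ] V)) (g h : H) :
    classOp ρ (g * h * g⁻¹) = classOp ρ h := by
  rw [classOp_eq, classOp_eq]
  refine Fintype.sum_equiv (Equiv.mulRight g) _ _ fun k => ?_
  simp only [Equiv.coe_mulRight, mul_inv_rev, inv_inv, mul_assoc]

theorem map_classOp {ρ : H →* (V ≃ₗᵢ[ℂ] V)} {ρ' : H →* (W ≃ₗᵢ[ℂ] W)} (M : V →ₗ[ℂ] W)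
    (α : MulAut H) (hM : ∀ h v, M (ρ h v) = ρ' (α h) (M v)) (h : H) (v : V) :
    M (classOp ρ h v) = classOp ρ' (α h) (M v) := by
  rw [classOp_apply, classOp_apply, map_sum]
  refine Fintype.sum_equiv α.toEquiv _ _ fun k => ?_
  simp only [map_add, map_smul, hM, map_mul α, map_inv α]
  rfl

theorem classOp_isSymmetric (ρ : H →* (V ≃ₗᵢ[ℂ] V)) (h : H) : (classOp ρ h).IsSymmetric := by
  intro v w
  rw [classOp_apply, classOp_apply, sum_inner, inner_sum]
  refine Finset.sum_congr rfl fun k _ => ?_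
  simp only [inner_add_left, inner_add_right, inner_smul_left, inner_smul_right, inner_apply_left,
    mul_inv_rev, inv_inv, mul_assoc, map_add, map_sub, map_one, Complex.conj_I]
  ring

theorem classOp_comm (ρ : H →* (V ≃ₗᵢ[ℂ] V)) (g h : H) (v : V) :
    ρ g (classOp ρ h v) = classOp ρ h (ρ g v) := by
  have := map_classOp (ρ := ρ) (ρ' := ρ) (ρ g).toLinearEquiv.toLinearMap (MulAut.conj g)
    (fun k v => by
      change ρ g (ρ k v) = ρ (g * k * g⁻¹) (ρ g v)
      simp) h v
  rw [MulAut.conj_apply, classOp_conj] at this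
  exact this

theorem classOp_commute (ρ : H →* (V ≃ₗᵢ[ℂ] V)) (g h : H) :
    Commute (classOp ρ g) (classOp ρ h) := by
  refine LinearMap.ext fun v => ?_
  rw [Module.End.mul_apply, Module.End.mul_apply, classOp_apply ρ g v,
    classOp_apply ρ g, map_sum]
  simp only [map_add, map_smul, classOp_comm]

variable (H) in
/-- The possible eigenvalues of the central operators. -/
def eigenvalueSet : Set ℂ := ⋃ h : H, {μ | (minpoly ℂ (classElem h)).IsRoot μ}

theorem finite_eigenvalueSet : (eigenvalueSet H).Finite :=
  Set.finite_iUnion fun h =>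
    Polynomial.finite_setOfPred_isRoot (minpoly.ne_zero (IsIntegral.of_finite ℂ (classElem h)))

theorem mem_eigenvalueSet {ρ : H →* (V ≃ₗᵢ[ℂ] V)} {h : H} {μ : ℂ} {v : V} (hv : v ≠ 0)
    (h' : classOp ρ h v = μ • v) : μ ∈ eigenvalueSet H := by
  refine Set.mem_iUnion.2 ⟨h, ?_⟩
  have h1 := aeval_apply_of_mem_apply_eq_smul (p := minpoly ℂ (classElem h)) h'
  rw [classOp, Polynomial.aeval_algHom_apply, minpoly.aeval, map_zero, LinearMap.zero_apply] at h1
  exact (smul_eq_zero.1 h1.symm).resolve_right hv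

variable (H) in
/-- The types of irreducible representations, given by the eigenvalues of central elements. -/
def CharType : Type _ := H → eigenvalueSet H

instance : Finite (CharType H) := by
  have := finite_eigenvalueSet (H := H).to_subtype
  exact Pi.finite

instance : MulAction (MulAut H) (CharType H) where
  smul α τ := fun h => τ (α⁻¹ h)
  one_smul τ := rfl
  mul_smul α β τ := by
    funext h
    change τ ((α * β)⁻¹ h) = τ (β⁻¹ (α⁻¹ h))
    rw [mul_inv_rev, MulAut.mul_apply]

/-- The joint eigenspaces of the central operators. -/
def isotypic (ρ : H →* (V ≃ₗᵢ[ℂ] V)) (τ : H → ℂ) : Submodule ℂ V :=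
  ⨅ h, eigenspace (classOp ρ h) (τ h)

theorem mem_isotypic {ρ : H →* (V ≃ₗᵢ[ℂ] V)} {τ : H → ℂ} {v : V} :
    v ∈ isotypic ρ τ ↔ ∀ h, classOp ρ h v = τ h • v := by
  simp [isotypic]

/-- The isotypic component of a type. -/
def component (ρ : H →* (V ≃ₗᵢ[ℂ] V)) (τ : CharType H) : Submodule ℂ V :=
  isotypic ρ fun h => τ h

/-- The dimension of the isotypic component of a type. -/
def mult (ρ : H →* (V ≃ₗᵢ[ℂ] V)) (τ : CharType H) : ℕ := Module.finrank ℂ (component ρ τ)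

theorem mem_component {ρ : H →* (V ≃ₗᵢ[ℂ] V)} {τ : CharType H} {v : V} :
    v ∈ component ρ τ ↔ ∀ h, classOp ρ h v = (τ h : ℂ) • v := mem_isotypic

theorem map_mem_component {ρ : H →* (V ≃ₗᵢ[ℂ] V)} {ρ' : H →* (W ≃ₗᵢ[ℂ] W)} (M : V →ₗ[ℂ] W)
    (α : MulAut H) (hM : ∀ h v, M (ρ h v) = ρ' (α h) (M v)) {τ : CharType H} {v : V}
    (hv : v ∈ component ρ τ) : M v ∈ component ρ' (α • τ) := by
  rw [mem_component] at hv ⊢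
  intro h
  have := map_classOp M α hM (α⁻¹ h) v
  rw [hv, map_smul, ← MulAut.mul_apply, mul_inv_cancel, MulAut.one_apply] at this
  exact this.symm

theorem orthogonalFamily_component (ρ : H →* (V ≃ₗᵢ[ℂ] V)) :
    OrthogonalFamily ℂ (fun τ : CharType H => component ρ τ)
      fun τ => (component ρ τ).subtypeₗᵢ :=
  (LinearMap.IsSymmetric.orthogonalFamily_iInf_eigenspaces (classOp_isSymmetric ρ)).comp
    (γ := CharType H) (f := fun τ h => (τ h : ℂ))
    fun _ _ h => funext fun k => Subtype.ext (congrFun h k)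

theorem isOrtho_component (ρ : H →* (V ≃ₗᵢ[ℂ] V)) {τ τ' : CharType H} (h : τ ≠ τ') :
    component ρ τ ⟂ component ρ τ' :=
  (orthogonalFamily_component ρ).isOrtho h

theorem trace_classOp_eq (ρ : H →* (V ≃ₗᵢ[ℂ] V)) (h : H) :
    LinearMap.trace ℂ V (classOp ρ h) =
      Fintype.card H * ((1 + Complex.I) * LinearMap.trace ℂ V (toRep ρ h) +
        (1 - Complex.I) * LinearMap.trace ℂ V (toRep ρ h⁻¹)) := by
  rw [classOp_eq, map_sum]
  simp only [map_add, map_smul, trace_toRep_conj]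
  simp
  ring

variable [FiniteDimensional ℂ V] [FiniteDimensional ℂ W] [FiniteDimensional ℂ A]
  [FiniteDimensional ℂ B]

theorem iSup_component (ρ : H →* (V ≃ₗᵢ[ℂ] V)) : ⨆ τ : CharType H, component ρ τ = ⊤ := by
  rw [eq_top_iff, ← LinearMap.IsSymmetric.iSup_iInf_eq_top_of_commute (classOp_isSymmetric ρ)
    fun g h _ => classOp_commute ρ g h]
  refine iSup_le fun χ => ?_
  by_cases hχ : ∀ h, χ h ∈ eigenvalueSet H
  · exact le_iSup (component ρ) fun h => ⟨χ h, hχ h⟩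
  · push Not at hχ
    obtain ⟨h, hh⟩ := hχ
    intro v hv
    have hv' : v = 0 := by
      by_contra hv0
      exact hh (mem_eigenvalueSet hv0 (mem_isotypic.1 hv h))
    rw [hv']
    exact Submodule.zero_mem _

theorem isInternal_component [DecidableEq (CharType H)] (ρ : H →* (V ≃ₗᵢ[ℂ] V)) :
    DirectSum.IsInternal (component ρ) := by
  rw [(orthogonalFamily_component ρ).isInternal_iff, iSup_component, Submodule.top_orthogonal_eq_bot]

theorem sum_mult [Fintype (CharType H)] (ρ : H →* (V ≃ₗᵢ[ℂ] V)) :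
    ∑ τ, mult ρ τ = Module.finrank ℂ V := by
  classical
  rw [← (LinearEquiv.ofBijective (DirectSum.coeLinearMap (component ρ))
    (isInternal_component ρ)).finrank_eq, Module.finrank_directSum]
  rfl

theorem mult_le_add_finrank_ker {ρ : H →* (V ≃ₗᵢ[ℂ] V)} {ρ' : H →* (W ≃ₗᵢ[ℂ] W)} (M : V →ₗ[ℂ] W)
    (α : MulAut H) (hM : ∀ h v, M (ρ h v) = ρ' (α h) (M v)) (τ : CharType H) :
    mult ρ τ ≤ mult ρ' (α • τ) + Module.finrank ℂ (LinearMap.ker M) := by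
  let R : component ρ τ →ₗ[ℂ] component ρ' (α • τ) :=
    M.restrict fun v hv => map_mem_component M α hM hv
  have h1 := LinearMap.finrank_range_add_finrank_ker R
  have h2 := Submodule.finrank_le (LinearMap.range R)
  have h3 : Module.finrank ℂ (LinearMap.ker R) ≤ Module.finrank ℂ (LinearMap.ker M) := by
    refine LinearMap.finrank_le_finrank_of_injective
      (f := ((component ρ τ).subtype ∘ₗ (LinearMap.ker R).subtype).codRestrict
        (LinearMap.ker M) fun v => ?_) ?_
    · exact congrArg Subtype.val v.2
    · intro v w hvw
      have h4 := congrArg Subtype.val hvw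
      exact Subtype.ext (Subtype.ext h4)
  simp only [mult]
  omega

theorem mult_le_of_injective {ρ : H →* (V ≃ₗᵢ[ℂ] V)} {ρ' : H →* (W ≃ₗᵢ[ℂ] W)} (M : V →ₗ[ℂ] W)
    (hinj : Function.Injective M) (α : MulAut H) (hM : ∀ h v, M (ρ h v) = ρ' (α h) (M v))
    (τ : CharType H) : mult ρ τ ≤ mult ρ' (α • τ) := by
  have := mult_le_add_finrank_ker M α hM τ
  rwa [LinearMap.ker_eq_bot.2 hinj, finrank_bot, add_zero] at this

theorem mult_comp (ρ : H →* (V ≃ₗᵢ[ℂ] V)) (α : MulAut H) (τ : CharType H) :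
    mult (ρ.comp α.toMonoidHom) τ = mult ρ (α • τ) := by
  refine le_antisymm (mult_le_of_injective LinearMap.id Function.injective_id α
    (fun _ _ => rfl) τ) ?_
  have := mult_le_of_injective (ρ := ρ) (ρ' := ρ.comp α.toMonoidHom) LinearMap.id
    Function.injective_id α⁻¹ (fun h v => ?_) (α • τ)
  · rwa [inv_smul_smul] at this
  · change ρ h v = ρ (α (α⁻¹ h)) v
    rw [← MulAut.mul_apply, mul_inv_cancel, MulAut.one_apply]

theorem mult_congr {ρ : H →* (V ≃ₗᵢ[ℂ] V)} {ρ' : H →* (W ≃ₗᵢ[ℂ] W)} (u : V ≃ₗᵢ[ℂ] W)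
    (hu : ∀ h v, u (ρ h v) = ρ' h (u v)) (τ : CharType H) : mult ρ τ = mult ρ' τ := by
  refine le_antisymm ?_ ?_
  · simpa using mult_le_of_injective u.toLinearEquiv.toLinearMap u.injective 1 hu τ
  · refine (mult_le_of_injective u.symm.toLinearEquiv.toLinearMap u.symm.injective 1
      (fun h v => ?_) τ).trans_eq (by rw [one_smul])
    apply u.injective
    change u (u.symm (ρ' h v)) = u (ρ h (u.symm v))
    rw [hu]
    simp

theorem mult_sumHom (e : V ≃ₗᵢ[ℂ] WithLp 2 (A × B)) (ρ : H →* (A ≃ₗᵢ[ℂ] A))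
    (ρ' : H →* (B ≃ₗᵢ[ℂ] B)) (τ : CharType H) :
    mult ((HilbertSum.sumHom e).comp (ρ.prod ρ')) τ = mult ρ τ + mult ρ' τ := by
  have := Fintype.ofFinite (CharType H)
  set J := (HilbertSum.sumHom e).comp (ρ.prod ρ') with hJ
  let P : V →ₗ[ℂ] A :=
    LinearMap.fst ℂ A B ∘ₗ (WithLp.linearEquiv 2 ℂ (A × B)).toLinearMap ∘ₗ
      e.toLinearEquiv.toLinearMap
  let Q : V →ₗ[ℂ] B :=
    LinearMap.snd ℂ A B ∘ₗ (WithLp.linearEquiv 2 ℂ (A × B)).toLinearMap ∘ₗ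
      e.toLinearEquiv.toLinearMap
  have hPQ : ∀ v, HilbertSum.inl e (P v) + HilbertSum.inr e (Q v) = v :=
    HilbertSum.inl_fst_add_inr_snd e
  have hcomm : ∀ h v, P (J h v) = ρ h (P v) ∧ Q (J h v) = ρ' h (Q v) := fun h v => by
    rw [← HilbertSum.inl_add_inr_eq_iff e, hPQ]
    conv_lhs => rw [← hPQ v, map_add]
    simp [hJ]
  have hle : ∀ τ, mult J τ ≤ mult ρ τ + mult ρ' τ := fun τ => by
    let R : component J τ →ₗ[ℂ] component ρ τ × component ρ' τ :=
      (P.restrict fun v hv => by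
        simpa using map_mem_component P 1 (fun h v => (hcomm h v).1) hv).prod
      (Q.restrict fun v hv => by
        simpa using map_mem_component Q 1 (fun h v => (hcomm h v).2) hv)
    have hR : Function.Injective R := fun v w hvw => by
      have h1 : P v = P w := congrArg (fun x => (x.1 : A)) hvw
      have h2 : Q v = Q w := congrArg (fun x => (x.2 : B)) hvw
      rw [Subtype.ext_iff, ← hPQ v, ← hPQ w, h1, h2]
    exact (LinearMap.finrank_le_finrank_of_injective hR).trans_eq (Module.finrank_prod)
  have hsum : ∑ τ, mult J τ = ∑ τ, (mult ρ τ + mult ρ' τ) := by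
    rw [Finset.sum_add_distrib, sum_mult, sum_mult, sum_mult, e.toLinearEquiv.finrank_eq,
      (WithLp.linearEquiv 2 ℂ (A × B)).finrank_eq, Module.finrank_prod]
  exact (Finset.sum_eq_sum_iff_of_le fun τ _ => hle τ).1 hsum τ (Finset.mem_univ τ)

theorem trace_classOp [Fintype (CharType H)] (ρ : H →* (V ≃ₗᵢ[ℂ] V)) (h : H) :
    LinearMap.trace ℂ V (classOp ρ h) = ∑ τ : CharType H, (τ h : ℂ) * mult ρ τ := by
  classical
  have hmap : ∀ τ : CharType H, Set.MapsTo (classOp ρ h) (component ρ τ) (component ρ τ) :=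
    fun τ v hv => by
      rw [SetLike.mem_coe, mem_component.1 hv h]
      exact Submodule.smul_mem _ _ hv
  rw [LinearMap.trace_eq_sum_trace_restrict (isInternal_component ρ) hmap]
  refine Finset.sum_congr rfl fun τ _ => ?_
  have : (classOp ρ h).restrict (hmap τ) = (τ h : ℂ) • LinearMap.id := by
    ext v
    exact mem_component.1 v.2 h
  rw [this, map_smul, LinearMap.trace_id, smul_eq_mul]
  rfl

theorem trace_eq_of_mult_eq {ρ : H →* (V ≃ₗᵢ[ℂ] V)} {ρ' : H →* (W ≃ₗᵢ[ℂ] W)}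
    (h : ∀ τ, mult ρ τ = mult ρ' τ) (k : H) :
    LinearMap.trace ℂ V (toRep ρ k) = LinearMap.trace ℂ W (toRep ρ' k) := by
  have := Fintype.ofFinite (CharType H)
  have key : ∀ k, (1 + Complex.I) * LinearMap.trace ℂ V (toRep ρ k) +
      (1 - Complex.I) * LinearMap.trace ℂ V (toRep ρ k⁻¹) =
      (1 + Complex.I) * LinearMap.trace ℂ W (toRep ρ' k) +
      (1 - Complex.I) * LinearMap.trace ℂ W (toRep ρ' k⁻¹) := fun k => by
    have h1 : (Fintype.card H : ℂ) ≠ 0 := by simp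
    apply mul_left_cancel₀ h1
    rw [← trace_classOp_eq, ← trace_classOp_eq, trace_classOp, trace_classOp]
    simp only [h]
  have h1 := key k
  have h2 := key k⁻¹
  rw [inv_inv] at h2
  have hI := Complex.I_mul_I
  linear_combination (1 / 4) * (1 - Complex.I) * h1 + (1 / 4) * (1 + Complex.I) * h2 +
    (1 / 2) * (LinearMap.trace ℂ V (toRep ρ k) - LinearMap.trace ℂ W (toRep ρ' k) -
      LinearMap.trace ℂ V (toRep ρ k⁻¹) + LinearMap.trace ℂ W (toRep ρ' k⁻¹)) * hI

variable (H) in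
/-- The type of the trivial representation. -/
def trivType : CharType H := fun h => ⟨2 * Fintype.card H, by
  refine mem_eigenvalueSet (ρ := (1 : H →* (ℂ ≃ₗᵢ[ℂ] ℂ))) (h := h) (v := 1) one_ne_zero ?_
  rw [classOp_apply]
  simp
  ring⟩

theorem mult_one {τ : CharType H} (hτ : τ ≠ trivType H) :
    mult (1 : H →* (V ≃ₗᵢ[ℂ] V)) τ = 0 := by
  rw [mult, Submodule.finrank_eq_zero, eq_bot_iff]
  intro v hv
  by_contra hv0
  refine hτ (funext fun h => Subtype.ext ?_)
  have h1 := mem_component.1 hv h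
  rw [classOp_apply] at h1
  simp only [MonoidHom.one_apply, LinearIsometryEquiv.coe_one, id, ← add_smul, Finset.sum_const,
    ← Nat.cast_smul_eq_nsmul ℂ, smul_smul] at h1
  rw [← smul_left_injective ℂ hv0 h1, trivType, Finset.card_univ]
  ring

theorem exists_splitting_component (ρ : H →* (V ≃ₗᵢ[ℂ] V)) (O : Set (CharType H)) :
    ∃ U : Submodule ℂ V,
      (∀ (α : MulAut H) (a : V ≃ₗᵢ[ℂ] V), (∀ h, ρ (α h) = a * ρ h * a⁻¹) →
        (∀ τ, α • τ ∈ O ↔ τ ∈ O) → a ∈ (HilbertSum.sumHom U.orthogonalDecomposition).range) ∧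
      ∀ (ρA : H →* (U ≃ₗᵢ[ℂ] U)) (ρB : H →* (Uᗮ ≃ₗᵢ[ℂ] Uᗮ)),
        (HilbertSum.sumHom U.orthogonalDecomposition).comp (ρA.prod ρB) = ρ →
          (∀ τ ∉ O, mult ρA τ = 0) ∧ ∀ τ ∈ O, mult ρB τ = 0 := by
  obtain ⟨U, hU⟩ : ∃ U : Submodule ℂ V, U = ⨆ τ ∈ O, component ρ τ := ⟨_, rfl⟩
  have hle : ∀ τ ∈ O, component ρ τ ≤ U := fun τ hτ => hU ▸ le_iSup₂_of_le τ hτ le_rfl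
  refine ⟨U, fun α a ha hO => ?_, fun ρA ρB hρ => ?_⟩
  · have haU : ∀ v ∈ U, a v ∈ U := by
      suffices U ≤ U.comap a.toLinearEquiv.toLinearMap from fun v hv => this hv
      refine hU.trans_le (iSup₂_le fun τ hτ v hv => ?_)
      have h1 : a v ∈ component ρ (α • τ) :=
        map_mem_component a.toLinearEquiv.toLinearMap α (fun h v => by simp [ha]) hv
      exact hle _ ((hO τ).2 hτ) h1
    let aU : U ≃ₗᵢ[ℂ] U :=
      LinearIsometry.toLinearIsometryEquiv
        { toLinearMap := a.toLinearEquiv.toLinearMap.restrict haU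
          norm_map' := fun v => a.norm_map v } rfl
    have haU' : ∀ v ∈ Uᗮ, a v ∈ Uᗮ := fun v hv => by
      rw [Submodule.mem_orthogonal] at hv ⊢
      intro u hu
      obtain ⟨u', hu'⟩ := aU.surjective ⟨u, hu⟩
      have h1 : a u' = u := congrArg Subtype.val hu'
      rw [← h1, a.inner_map_map]
      exact hv _ u'.2
    let aU' : Uᗮ ≃ₗᵢ[ℂ] Uᗮ :=
      LinearIsometry.toLinearIsometryEquiv
        { toLinearMap := a.toLinearEquiv.toLinearMap.restrict haU'
          norm_map' := fun v => a.norm_map v } rfl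
    refine ⟨(aU, aU'), ?_⟩
    ext v
    rw [← HilbertSum.inl_fst_add_inr_snd U.orthogonalDecomposition v, map_add, map_add,
      HilbertSum.sumHom_inl, HilbertSum.sumHom_inr]
    simp only [HilbertSchmidt.inl_orthogonalDecomposition,
      HilbertSchmidt.inr_orthogonalDecomposition]
    rfl
  · have hρ' : ∀ h w, ρ h w = HilbertSum.sumHom U.orthogonalDecomposition (ρA h, ρB h) w :=
      fun h w => congrArg (fun f : V ≃ₗᵢ[ℂ] V => f w) (DFunLike.congr_fun hρ h).symm
    refine ⟨fun τ hτ => ?_, fun τ hτ => ?_⟩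
    · rw [mult, Submodule.finrank_eq_zero, eq_bot_iff]
      intro v hv
      have h1 := map_mem_component (ρ' := ρ) (HilbertSum.inl U.orthogonalDecomposition) 1
        (fun h v => ((hρ' h _).trans (HilbertSum.sumHom_inl _ _ _ v)).symm) hv
      rw [one_smul, HilbertSchmidt.inl_orthogonalDecomposition] at h1
      have h2 : component ρ τ ⟂ U := by
        simp only [hU, Submodule.isOrtho_iSup_right]
        exact fun σ hσ => isOrtho_component ρ fun h => hτ (h ▸ hσ)
      have h3 := h2.inner_eq h1 v.2
      rw [inner_self_eq_zero] at h3
      simpa using h3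
    · rw [mult, Submodule.finrank_eq_zero, eq_bot_iff]
      intro v hv
      have h1 := map_mem_component (ρ' := ρ) (HilbertSum.inr U.orthogonalDecomposition) 1
        (fun h v => ((hρ' h _).trans (HilbertSum.sumHom_inr _ _ _ v)).symm) hv
      rw [one_smul, HilbertSchmidt.inr_orthogonalDecomposition] at h1
      have h3 := Submodule.inner_right_of_mem_orthogonal (hle τ hτ h1) v.2
      rw [inner_self_eq_zero] at h3
      simpa using h3

end UnitaryRep

/-- A polar decomposition of a linear map with prescribed unitary part on the kernel: the unitary
part acts on the eigenspaces of `A† A` as a multiple of `A`. -/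
theorem LinearMap.exists_polar {V W : Type*} [NormedAddCommGroup V] [InnerProductSpace ℂ V]
    [FiniteDimensional ℂ V] [NormedAddCommGroup W] [InnerProductSpace ℂ W]
    [FiniteDimensional ℂ W] (A M : V →ₗ[ℂ] W)
    (hdim : Module.finrank ℂ V = Module.finrank ℂ W)
    (hM : ∀ x ∈ LinearMap.ker A, ∀ y ∈ LinearMap.ker A, inner ℂ (M x) (M y) = inner ℂ x y)
    (hMA : ∀ x ∈ LinearMap.ker A, ∀ y, inner ℂ (M x) (A y) = 0) :
    ∃ U : V ≃ₗᵢ[ℂ] W, (∀ x ∈ LinearMap.ker A, U x = M x) ∧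
      (∀ r : ℝ, r ≠ 0 → ∀ x, (LinearMap.adjoint A ∘ₗ A) x = (r : ℂ) • x →
        U x = ((√r)⁻¹ : ℂ) • A x) ∧
      ∃ b : OrthonormalBasis (Fin (Module.finrank ℂ V)) ℂ V, ∀ i, ∃ r : ℝ,
        (LinearMap.adjoint A ∘ₗ A) (b i) = (r : ℂ) • b i ∧ 0 ≤ r ∧
          A (b i) = ((√r : ℝ) : ℂ) • U (b i) := by
  classical
  have hS : (LinearMap.adjoint A ∘ₗ A).IsSymmetric := LinearMap.isSymmetric_adjoint_comp_self A
  let b := hS.eigenvectorBasis rfl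
  let r := hS.eigenvalues rfl
  have hb : ∀ i, (LinearMap.adjoint A ∘ₗ A) (b i) = (r i : ℂ) • b i :=
    hS.apply_eigenvectorBasis rfl
  have hinner : ∀ i j, inner ℂ (A (b i)) (A (b j)) = if i = j then (r j : ℂ) else 0 := by
    intro i j
    rw [← LinearMap.adjoint_inner_right, ← LinearMap.comp_apply, hb, inner_smul_right,
      orthonormal_iff_ite.1 b.orthonormal]
    split_ifs <;> simp
  have hnorm : ∀ i, r i = ‖A (b i)‖ ^ 2 := fun i => by
    have h := hinner i i
    rw [if_pos rfl, inner_self_eq_norm_sq_to_K] at h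
    exact Complex.ofReal_injective (by rw [Complex.ofReal_pow]; exact h.symm)
  have hr0 : ∀ i, 0 ≤ r i := fun i => by rw [hnorm]; positivity
  have hker : ∀ i, r i = 0 → b i ∈ LinearMap.ker A := fun i hi => by
    rw [LinearMap.mem_ker, ← norm_eq_zero, ← sq_eq_zero_iff, ← hnorm, hi]
  let u : Fin (Module.finrank ℂ V) → W := fun i =>
    if r i = 0 then M (b i) else ((√(r i))⁻¹ : ℂ) • A (b i)
  have hu : Orthonormal ℂ u := by
    rw [orthonormal_iff_ite]
    intro i j
    by_cases hi : r i = 0 <;> by_cases hj : r j = 0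
    · simp only [u, if_pos hi, if_pos hj]
      rw [hM _ (hker i hi) _ (hker j hj), orthonormal_iff_ite.1 b.orthonormal]
    · simp only [u, if_pos hi, if_neg hj]
      rw [inner_smul_right, hMA _ (hker i hi), mul_zero, if_neg]
      rintro rfl
      exact hj hi
    · simp only [u, if_neg hi, if_pos hj]
      rw [inner_smul_left, ← inner_conj_symm, hMA _ (hker j hj), map_zero, mul_zero, if_neg]
      rintro rfl
      exact hi hj
    · simp only [u, if_neg hi, if_neg hj]
      rw [inner_smul_left, inner_smul_right, hinner]
      split_ifs with hij
      · subst hij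
        have h1 : (√(r i) : ℂ) * √(r i) = r i := by
          exact_mod_cast Real.mul_self_sqrt (hr0 i)
        have h2 : (√(r i) : ℂ) ≠ 0 := by
          exact_mod_cast (Real.sqrt_ne_zero (hr0 i)).2 hi
        rw [map_inv₀, Complex.conj_ofReal, ← h1]
        field_simp
      · simp
  let T : V →ₗ[ℂ] W := b.toBasis.constr ℂ u
  have hT : ∀ i, T (b i) = u i := fun i => by
    have := b.toBasis.constr_basis ℂ u i
    rwa [b.coe_toBasis] at this
  let U₀ : V →ₗᵢ[ℂ] W := T.isometryOfOrthonormal (v := b.toBasis)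
    (by rw [b.coe_toBasis]; exact b.orthonormal) (by
      rw [b.coe_toBasis]
      convert hu
      exact funext hT)
  let U : V ≃ₗᵢ[ℂ] W := U₀.toLinearIsometryEquiv hdim
  have hU : ∀ i, U (b i) = u i := hT
  have hcoord : ∀ (s : ℝ) (x : V), (LinearMap.adjoint A ∘ₗ A) x = (s : ℂ) • x →
      ∀ i, inner ℂ (b i) x ≠ 0 → r i = s := by
    intro s x hx i hi
    have h1 := hS (b i) x
    rw [hb, hx, inner_smul_left, inner_smul_right, Complex.conj_ofReal] at h1
    exact_mod_cast mul_right_cancel₀ hi h1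
  have hexp : ∀ (N N' : V →ₗ[ℂ] W) (x : V),
      (∀ i, inner ℂ (b i) x ≠ 0 → N (b i) = N' (b i)) → N x = N' x := by
    intro N N' x h
    rw [← b.sum_repr' x, map_sum, map_sum]
    refine Finset.sum_congr rfl fun i _ => ?_
    rw [map_smul, map_smul]
    by_cases hi : inner ℂ (b i) x = 0
    · rw [hi, zero_smul, zero_smul]
    · rw [h i hi]
  refine ⟨U, fun x hx => ?_, fun s hs x hx => ?_, b, fun i => ⟨r i, hb i, hr0 i, ?_⟩⟩
  · refine hexp U.toLinearEquiv.toLinearMap M x fun i hi => ?_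
    have h1 : r i = 0 := hcoord 0 x (by simp [LinearMap.mem_ker.1 hx]) i hi
    exact (hU i).trans (if_pos h1)
  · refine hexp U.toLinearEquiv.toLinearMap (((√s)⁻¹ : ℂ) • A) x fun i hi => ?_
    have h1 : r i = s := hcoord s x hx i hi
    refine (hU i).trans ((if_neg (h1.trans_ne hs)).trans ?_)
    rw [h1]
    rfl
  · rw [hU]
    by_cases hi : r i = 0
    · rw [hi, LinearMap.mem_ker.1 (hker i hi)]
      simp
    · have h2 : (√(r i) : ℂ) ≠ 0 := by
        exact_mod_cast (Real.sqrt_ne_zero (hr0 i)).2 hi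
      simp only [u, if_neg hi]
      rw [smul_smul, mul_inv_cancel₀ h2, one_smul]

namespace UnitaryRep

variable {H : Type*} [Group H]

section Restrict

variable {V : Type*} [NormedAddCommGroup V] [InnerProductSpace ℂ V]
  {ρ : H →* (V ≃ₗᵢ[ℂ] V)} {U : Submodule ℂ V}

theorem apply_mem_orthogonal (hU : ∀ h, ∀ v ∈ U, ρ h v ∈ U) (h : H) (v : V) (hv : v ∈ Uᗮ) :
    ρ h v ∈ Uᗮ := by
  rw [Submodule.mem_orthogonal] at hv ⊢
  intro u hu
  have := inner_apply_left ρ h⁻¹ u v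
  rw [inv_inv] at this
  rw [← this]
  exact hv _ (hU _ _ hu)

variable [FiniteDimensional ℂ V] (ρ U)

/-- The restriction of a unitary representation to an invariant subspace. -/
def restrict (hU : ∀ h, ∀ v ∈ U, ρ h v ∈ U) : H →* (U ≃ₗᵢ[ℂ] U) where
  toFun h := LinearIsometry.toLinearIsometryEquiv
    { toLinearMap := (ρ h).toLinearEquiv.toLinearMap.restrict (hU h)
      norm_map' := fun v => (ρ h).norm_map v } rfl
  map_one' := by
    ext v
    change ρ 1 v = v
    simp
  map_mul' g h := by
    ext v
    change ρ (g * h) v = ρ g (ρ h v)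
    simp

@[simp]
theorem coe_restrict_apply (hU : ∀ h, ∀ v ∈ U, ρ h v ∈ U) (h : H) (v : U) :
    (restrict ρ U hU h v : V) = ρ h v := rfl

variable {ρ U}

theorem mult_eq_restrict_add [Fintype H] (hU : ∀ h, ∀ v ∈ U, ρ h v ∈ U) (τ : CharType H) :
    mult ρ τ = mult (restrict ρ U hU) τ + mult (restrict ρ Uᗮ (apply_mem_orthogonal hU)) τ := by
  rw [← mult_sumHom U.orthogonalDecomposition]
  congr 1
  ext h v
  change ρ h v = HilbertSum.sumHom U.orthogonalDecomposition
    (restrict ρ U hU h, restrict ρ Uᗮ (apply_mem_orthogonal hU) h) v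
  rw [← HilbertSum.inl_fst_add_inr_snd U.orthogonalDecomposition v, map_add, map_add,
    HilbertSum.sumHom_inl, HilbertSum.sumHom_inr]
  simp only [HilbertSchmidt.inl_orthogonalDecomposition,
    HilbertSchmidt.inr_orthogonalDecomposition, coe_restrict_apply]

end Restrict

section Intertwiner

variable {V W : Type*} [NormedAddCommGroup V] [InnerProductSpace ℂ V] [FiniteDimensional ℂ V]
  [NormedAddCommGroup W] [InnerProductSpace ℂ W] [FiniteDimensional ℂ W]
  {ρ : H →* (V ≃ₗᵢ[ℂ] V)} {ρ' : H →* (W ≃ₗᵢ[ℂ] W)}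

theorem adjoint_comp_self_comm {A : V →ₗ[ℂ] W} (hA : ∀ h v, A (ρ h v) = ρ' h (A v)) (h : H)
    (v : V) : (LinearMap.adjoint A ∘ₗ A) (ρ h v) = ρ h ((LinearMap.adjoint A ∘ₗ A) v) := by
  refine ext_inner_right ℂ fun w => ?_
  rw [inner_apply_left, LinearMap.comp_apply, LinearMap.comp_apply, LinearMap.adjoint_inner_left,
    LinearMap.adjoint_inner_left, hA, hA, inner_apply_left]

variable [Fintype H]

theorem finrank_eq_of_mult_eq (h : ∀ τ, mult ρ τ = mult ρ' τ) :
    Module.finrank ℂ V = Module.finrank ℂ W := by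
  have := Fintype.ofFinite (CharType H)
  rw [← sum_mult ρ, ← sum_mult ρ']
  exact Finset.sum_congr rfl fun τ _ => h τ

theorem exists_intertwiner_ne_zero (hmult : ∀ τ, mult ρ τ = mult ρ' τ)
    (hV : Module.finrank ℂ V ≠ 0) :
    ∃ M : V →ₗ[ℂ] W, (∀ h v, M (ρ h v) = ρ' h (M v)) ∧ M ≠ 0 := by
  let M : V → W → V →ₗ[ℂ] W := fun x y =>
    ∑ h, ((innerSL ℂ (ρ h x)).toLinearMap.smulRight (ρ' h y))
  have hM : ∀ x y v, M x y v = ∑ h, inner ℂ (ρ h x) v • ρ' h y := fun x y v => by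
    simp [M, LinearMap.sum_apply]
  have hint : ∀ x y k v, M x y (ρ k v) = ρ' k (M x y v) := by
    intro x y k v
    rw [hM, hM, map_sum]
    refine (Fintype.sum_equiv (Equiv.mulLeft k) _ _ fun h => ?_).symm
    rw [map_smul, Equiv.coe_mulLeft, map_mul, map_mul]
    simp
  by_contra hcon
  push Not at hcon
  have hzero : ∀ x y v w, ∑ h, inner ℂ (ρ h x) v * inner ℂ w (ρ' h y) = 0 := by
    intro x y v w
    have h1 := hM x y v
    rw [hcon _ (hint x y), LinearMap.zero_apply] at h1
    have h2 := congrArg (inner ℂ w) h1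
    simpa [inner_sum, inner_smul_right] using h2.symm
  have htr : ∀ h, LinearMap.trace ℂ V (toRep ρ h) = LinearMap.trace ℂ W (toRep ρ' h) :=
    trace_eq_of_mult_eq hmult
  let b := stdOrthonormalBasis ℂ V
  let c := stdOrthonormalBasis ℂ W
  have hsum : ∑ h, (starRingEnd ℂ) (LinearMap.trace ℂ V (toRep ρ h)) *
      LinearMap.trace ℂ V (toRep ρ h) = 0 := by
    have h1 : ∀ h, (starRingEnd ℂ) (LinearMap.trace ℂ V (toRep ρ h)) *
        LinearMap.trace ℂ V (toRep ρ h) =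
        ∑ i, ∑ j, inner ℂ (ρ h (b i)) (b i) * inner ℂ (c j) (ρ' h (c j)) := fun h => by
      refine (congrArg ((starRingEnd ℂ) (LinearMap.trace ℂ V (toRep ρ h)) * ·) (htr h)).trans ?_
      rw [LinearMap.trace_eq_sum_inner _ c, LinearMap.trace_eq_sum_inner _ b, map_sum,
        Finset.sum_mul_sum]
      simp
    simp only [h1]
    rw [Finset.sum_comm]
    refine Finset.sum_eq_zero fun i _ => ?_
    rw [Finset.sum_comm]
    exact Finset.sum_eq_zero fun j _ => hzero _ _ _ _
  have hsum' : ∑ h, Complex.normSq (LinearMap.trace ℂ V (toRep ρ h)) = 0 := by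
    have : ((∑ h, Complex.normSq (LinearMap.trace ℂ V (toRep ρ h)) : ℝ) : ℂ) = 0 := by
      rw [← hsum, Complex.ofReal_sum]
      exact Finset.sum_congr rfl fun h _ => Complex.normSq_eq_conj_mul_self
    exact_mod_cast this
  have h1 := (Finset.sum_eq_zero_iff_of_nonneg fun h _ => Complex.normSq_nonneg _).1 hsum' 1
    (Finset.mem_univ _)
  rw [map_one, LinearMap.trace_one, map_eq_zero] at h1
  exact hV (by exact_mod_cast h1)

end Intertwiner

variable [Fintype H]

universe u v in
/-- An intertwiner of equivalent representations has an equivariant polar decomposition. -/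
theorem exists_equivariant_polar (n : ℕ) : ∀ {V : Type u} {W : Type v} [NormedAddCommGroup V]
    [InnerProductSpace ℂ V] [FiniteDimensional ℂ V] [NormedAddCommGroup W]
    [InnerProductSpace ℂ W] [FiniteDimensional ℂ W] (ρ : H →* (V ≃ₗᵢ[ℂ] V))
    (ρ' : H →* (W ≃ₗᵢ[ℂ] W)), (∀ τ, mult ρ τ = mult ρ' τ) → ∀ A : V →ₗ[ℂ] W,
    (∀ h v, A (ρ h v) = ρ' h (A v)) → Module.finrank ℂ (LinearMap.ker A) = n →
    ∃ U : V ≃ₗᵢ[ℂ] W, (∀ h v, U (ρ h v) = ρ' h (U v)) ∧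
      ∃ b : OrthonormalBasis (Fin (Module.finrank ℂ V)) ℂ V, ∀ i, ∃ r : ℝ,
        0 ≤ r ∧ A (b i) = (r : ℂ) • U (b i) := by
  induction n using Nat.strong_induction_on with
  | _ n ih =>
  intro V W _ _ _ _ _ _ ρ ρ' hmult A hA hn
  have hK : ∀ h, ∀ v ∈ LinearMap.ker A, ρ h v ∈ LinearMap.ker A := fun h v hv => by
    rw [LinearMap.mem_ker, hA, LinearMap.mem_ker.1 hv, map_zero]
  have hR : ∀ h, ∀ w ∈ LinearMap.range A, ρ' h w ∈ LinearMap.range A := by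
    rintro h _ ⟨v, rfl⟩
    exact ⟨ρ h v, hA h v⟩
  obtain ⟨U₀, hU₀, hU₀'⟩ : ∃ U₀ : LinearMap.ker A →ₗ[ℂ] (LinearMap.range A)ᗮ,
      (∀ x y, inner ℂ (U₀ x) (U₀ y) = inner ℂ x y) ∧
      ∀ h v, U₀ (restrict ρ _ hK h v) =
        restrict ρ' _ (apply_mem_orthogonal hR) h (U₀ v) := by
    by_cases h0 : Module.finrank ℂ (LinearMap.ker A) = 0
    · have := Module.finrank_zero_iff.1 h0
      exact ⟨0, fun x y => by simp [Subsingleton.elim x 0], fun h v => by simp⟩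
    · have hKR : ∀ τ, mult (restrict ρ _ hK) τ =
          mult (restrict ρ' _ (apply_mem_orthogonal hR)) τ := by
        have := Fintype.ofFinite (CharType H)
        let Q : ((LinearMap.ker A)ᗮ : Submodule ℂ V) →ₗ[ℂ] LinearMap.range A :=
          A.rangeRestrict ∘ₗ (LinearMap.ker A)ᗮ.subtype
        have hQ : Function.Injective Q := by
          refine (injective_iff_map_eq_zero _).2 fun x hx => ?_
          have h1 : (x : V) ∈ LinearMap.ker A := congrArg Subtype.val hx
          have h2 := Submodule.inner_right_of_mem_orthogonal h1 x.2
          rw [inner_self_eq_zero] at h2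
          exact Subtype.ext h2
        have hle : ∀ τ, mult (restrict ρ _ (apply_mem_orthogonal hK)) τ ≤
            mult (restrict ρ' _ hR) τ := fun τ => by
          have := mult_le_of_injective (ρ := restrict ρ _ (apply_mem_orthogonal hK))
            (ρ' := restrict ρ' _ hR) Q hQ 1 (fun h v => Subtype.ext (hA h v)) τ
          rwa [one_smul] at this
        have hfin : Module.finrank ℂ ((LinearMap.ker A)ᗮ : Submodule ℂ V) =
            Module.finrank ℂ (LinearMap.range A) := by
          have h1 := Submodule.finrank_add_finrank_orthogonal (LinearMap.ker A)
          have h2 := LinearMap.finrank_range_add_finrank_ker A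
          omega
        have heq := (Finset.sum_eq_sum_iff_of_le fun τ (_ : τ ∈ Finset.univ) => hle τ).1
          (by rw [sum_mult, sum_mult, hfin])
        intro τ
        have h1 := hmult τ
        rw [mult_eq_restrict_add hK, mult_eq_restrict_add hR, heq τ (Finset.mem_univ τ)] at h1
        omega
      obtain ⟨M, hM, hM0⟩ := exists_intertwiner_ne_zero hKR h0
      have hlt : Module.finrank ℂ (LinearMap.ker M) < n := by
        rw [← hn]
        exact Submodule.finrank_lt fun h => hM0 (LinearMap.ker_eq_top.1 h)
      obtain ⟨U, hU, -⟩ := ih _ hlt _ _ hKR M hM rfl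
      exact ⟨U.toLinearEquiv.toLinearMap, fun x y => U.inner_map_map x y, hU⟩
  let M : V →ₗ[ℂ] W := (LinearMap.range A)ᗮ.subtype ∘ₗ U₀ ∘ₗ
    (LinearMap.ker A).orthogonalProjectionOnto.toLinearMap
  have hM : ∀ x : LinearMap.ker A, M x = U₀ x := fun x => by
    simp [M]
  obtain ⟨U, hUker, hUeig, b, hb⟩ := LinearMap.exists_polar A M (finrank_eq_of_mult_eq hmult)
    (fun x hx y hy => by
      rw [hM ⟨x, hx⟩, hM ⟨y, hy⟩]
      exact hU₀ ⟨x, hx⟩ ⟨y, hy⟩)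
    (fun x hx y => by
      rw [hM ⟨x, hx⟩]
      exact Submodule.inner_left_of_mem_orthogonal (LinearMap.mem_range_self A y) (U₀ ⟨x, hx⟩).2)
  refine ⟨U, fun h => ?_, b, fun i => ?_⟩
  · suffices U.toLinearEquiv.toLinearMap ∘ₗ toRep ρ h =
        toRep ρ' h ∘ₗ U.toLinearEquiv.toLinearMap from fun v => LinearMap.congr_fun this v
    refine b.toBasis.ext fun i => ?_
    rw [b.coe_toBasis]
    change U (ρ h (b i)) = ρ' h (U (b i))
    obtain ⟨r, hr, -, -⟩ := hb i
    by_cases hr0 : r = 0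
    · have hker : b i ∈ LinearMap.ker A := by
        rw [hr0, Complex.ofReal_zero, zero_smul] at hr
        rw [LinearMap.mem_ker, ← inner_self_eq_zero (𝕜 := ℂ), ← LinearMap.adjoint_inner_right,
          ← LinearMap.comp_apply, hr, inner_zero_right]
      rw [hUker _ hker, hUker _ (hK h _ hker), hM ⟨_, hker⟩, hM ⟨_, hK h _ hker⟩]
      exact congrArg Subtype.val (hU₀' h ⟨b i, hker⟩)
    · rw [hUeig r hr0 _ hr, hUeig r hr0 (ρ h (b i)) (by
        rw [adjoint_comp_self_comm hA, hr, map_smul]), hA, map_smul]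
  · obtain ⟨r, -, hr0, hr⟩ := hb i
    exact ⟨√r, Real.sqrt_nonneg r, hr⟩

section Average

variable {V : Type*} [NormedAddCommGroup V] [InnerProductSpace ℂ V] (ρ ρ' : H →* (V ≃ₗᵢ[ℂ] V))

/-- The average intertwiner between two representations on the same space. -/
def average : V →ₗ[ℂ] V :=
  (Fintype.card H : ℂ)⁻¹ • ∑ h, (ρ' h * (ρ h)⁻¹).toLinearEquiv.toLinearMap

theorem average_apply (v : V) :
    average ρ ρ' v = (Fintype.card H : ℂ)⁻¹ • ∑ h, ρ' h (ρ h⁻¹ v) := by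
  simp [average, LinearMap.sum_apply]

theorem average_comm (k : H) (v : V) : average ρ ρ' (ρ k v) = ρ' k (average ρ ρ' v) := by
  rw [average_apply, average_apply, map_smul, map_sum]
  congr 1
  refine (Fintype.sum_equiv (Equiv.mulLeft k) _ _ fun h => ?_).symm
  simp

variable [FiniteDimensional ℂ V]

theorem normSq_average_sub_one_le :
    HilbertSchmidt.normSq (average ρ ρ' - LinearMap.id) ≤
      ∑ h, HilbertSchmidt.gap (ρ h) (ρ' h) := by
  have hc : (Fintype.card H : ℂ) ≠ 0 := by simp
  have hcR : (1 : ℝ) ≤ Fintype.card H := by exact_mod_cast Fintype.card_pos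
  have h1 : average ρ ρ' - LinearMap.id = (Fintype.card H : ℂ)⁻¹ •
      ∑ h, ((ρ' h * (ρ h)⁻¹).toLinearEquiv.toLinearMap -
        (1 : V ≃ₗᵢ[ℂ] V).toLinearEquiv.toLinearMap) := by
    rw [Finset.sum_sub_distrib, smul_sub, average]
    congr 1
    rw [Finset.sum_const, Finset.card_univ, ← Nat.cast_smul_eq_nsmul ℂ, smul_smul,
      inv_mul_cancel₀ hc, one_smul]
    rfl
  have h2 : ∀ h, HilbertSchmidt.gap (ρ' h * (ρ h)⁻¹) 1 = HilbertSchmidt.gap (ρ h) (ρ' h) :=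
    fun h => by
      rw [← HilbertSchmidt.gap_mul_right (ρ h), inv_mul_cancel_right, one_mul,
        HilbertSchmidt.gap_comm]
  rw [h1, HilbertSchmidt.normSq_smul]
  have h3 := HilbertSchmidt.normSq_sum_le Finset.univ fun h =>
    (ρ' h * (ρ h)⁻¹).toLinearEquiv.toLinearMap - (1 : V ≃ₗᵢ[ℂ] V).toLinearEquiv.toLinearMap
  change _ ≤ _ * ∑ h, HilbertSchmidt.gap (ρ' h * (ρ h)⁻¹) 1 at h3
  simp only [h2, Finset.card_univ] at h3
  have h4 : 0 ≤ ∑ h, HilbertSchmidt.gap (ρ h) (ρ' h) :=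
    Finset.sum_nonneg fun h _ => HilbertSchmidt.gap_nonneg _ _
  rw [norm_inv, Complex.norm_natCast, inv_pow, inv_mul_le_iff₀ (by positivity)]
  refine h3.trans ?_
  have h5 : (Fintype.card H : ℝ) ≤ (Fintype.card H : ℝ) ^ 2 := by nlinarith
  exact mul_le_mul_of_nonneg_right h5 h4

theorem mult_sub_le (τ : CharType H) :
    (mult ρ τ : ℝ) - mult ρ' τ ≤ ∑ h, HilbertSchmidt.gap (ρ h) (ρ' h) := by
  refine le_trans ?_ (normSq_average_sub_one_le ρ ρ')
  have h1 := mult_le_add_finrank_ker (average ρ ρ') 1 (average_comm ρ ρ') τ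
  rw [one_smul] at h1
  have h2 := HilbertSchmidt.finrank_le_normSq (average ρ ρ' - LinearMap.id)
    (LinearMap.ker (average ρ ρ')) fun x hx => by
      simp [LinearMap.mem_ker.1 hx]
  have h3 : (mult ρ τ : ℝ) ≤ mult ρ' τ +
      Module.finrank ℂ (LinearMap.ker (average ρ ρ')) := by exact_mod_cast h1
  linarith

theorem exists_conj_of_mult_eq (h : ∀ τ, mult ρ τ = mult ρ' τ) :
    ∃ u : V ≃ₗᵢ[ℂ] V, (∀ h, u * ρ h * u⁻¹ = ρ' h) ∧
      HilbertSchmidt.gap u 1 ≤ 4 * ∑ h, HilbertSchmidt.gap (ρ h) (ρ' h) := by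
  obtain ⟨U, hU, b, hb⟩ := exists_equivariant_polar _ ρ ρ' h (average ρ ρ')
    (average_comm ρ ρ') rfl
  refine ⟨U, fun h => ?_, ?_⟩
  · rw [mul_inv_eq_iff_eq_mul]
    ext v
    exact hU h v
  · refine le_trans ?_ (mul_le_mul_of_nonneg_left (normSq_average_sub_one_le ρ ρ') (by norm_num))
    rw [HilbertSchmidt.gap, HilbertSchmidt.normSq_eq_sum _ b, HilbertSchmidt.normSq_eq_sum _ b,
      Finset.mul_sum]
    refine Finset.sum_le_sum fun i _ => ?_
    obtain ⟨r, hr0, hr⟩ := hb i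
    simp only [LinearMap.sub_apply, LinearMap.id_apply]
    change ‖U (b i) - b i‖ ^ 2 ≤ 4 * ‖average ρ ρ' (b i) - b i‖ ^ 2
    have hnU : ‖U (b i)‖ = 1 := by rw [U.norm_map, b.norm_eq_one]
    have h1 : ‖U (b i) - average ρ ρ' (b i)‖ ≤ ‖average ρ ρ' (b i) - b i‖ := by
      have h2 : ‖U (b i) - average ρ ρ' (b i)‖ = |1 - r| := by
        rw [hr]
        nth_rewrite 1 [← one_smul ℂ (U (b i))]
        rw [← sub_smul, norm_smul, hnU, mul_one, ← Complex.ofReal_one, ← Complex.ofReal_sub,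
          Complex.norm_real, Real.norm_eq_abs]
      have h3 : ‖average ρ ρ' (b i)‖ = r := by
        rw [hr, norm_smul, hnU, mul_one, Complex.norm_real, Real.norm_of_nonneg hr0]
      have h4 := abs_norm_sub_norm_le (average ρ ρ' (b i)) (b i)
      rw [h3, b.norm_eq_one, abs_sub_comm] at h4
      rwa [h2]
    have h5 : ‖U (b i) - b i‖ ≤ 2 * ‖average ρ ρ' (b i) - b i‖ := by
      have := norm_sub_le_norm_sub_add_norm_sub (U (b i)) (average ρ ρ' (b i)) (b i)
      linarith
    calc ‖U (b i) - b i‖ ^ 2 ≤ (2 * ‖average ρ ρ' (b i) - b i‖) ^ 2 := by gcongr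
      _ = _ := by ring

end Average

end UnitaryRep

/-- Unitary groups with the square of the Hilbert-Schmidt distance as gap, and with the dimensions
of the isotypic components as multiplicities. -/
def unitaryMultiplicitySystem (H : Type*) [Group H] [Fintype H] :
    MultiplicitySystem FdHilb.Aut H (UnitaryRep.CharType H) where
  size X := Module.finrank ℂ X.carrier
  gap := HilbertSchmidt.gap
  mult := UnitaryRep.mult

theorem isSplitting_hilbertSum (H : Type*) [Group H] [Fintype H] {X A B : FdHilb}
    (e : X.carrier ≃ₗᵢ[ℂ] WithLp 2 (A.carrier × B.carrier)) :
    (unitaryMultiplicitySystem H).IsSplitting (X := X) (A := A) (B := B)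
      (HilbertSum.sumHom e) where
  injective := HilbertSum.sumHom_injective e
  size_eq := (e.toLinearEquiv.trans (WithLp.linearEquiv 2 ℂ _)).finrank_eq.trans
    (Module.finrank_prod ..)
  gap_eq := HilbertSchmidt.gap_sumHom e
  mult_eq := UnitaryRep.mult_sumHom e
  near := HilbertSchmidt.exists_gap_sumHom_le e

/-- The surgery system of unitary groups, in which the types are the central characters. -/
def unitarySystem (H : Type*) [Group H] [Fintype H] [Fintype (UnitaryRep.CharType H)] :
    SurgerySystem FdHilb.Aut H (UnitaryRep.CharType H) where
  size X := Module.finrank ℂ X.carrier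
  gap := HilbertSchmidt.gap
  mult := UnitaryRep.mult
  gap_nonneg := HilbertSchmidt.gap_nonneg
  gap_self a := by simp [HilbertSchmidt.gap]
  gap_comm := HilbertSchmidt.gap_comm
  gap_triangle := HilbertSchmidt.gap_triangle
  gap_mul_left := HilbertSchmidt.gap_mul_left
  gap_mul_right := HilbertSchmidt.gap_mul_right
  gap_le := HilbertSchmidt.gap_le
  sum_mult := UnitaryRep.sum_mult
  mult_comp := UnitaryRep.mult_comp
  mult_conj ρ u τ := (UnitaryRep.mult_congr u (fun h v => by simp) τ).symm
  mult_sub_le ρ ρ' := UnitaryRep.mult_sub_le ρ ρ'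
  triv := UnitaryRep.trivType H
  smul_triv _ := funext fun _ => rfl
  mult_one _ := UnitaryRep.mult_one
  exists_splitting_size X k hk := by
    obtain ⟨U, hU⟩ := Submodule.exists_finrank_eq_of_le hk
    exact ⟨⟨U⟩, ⟨Uᗮ⟩, HilbertSum.sumHom U.orthogonalDecomposition,
      isSplitting_hilbertSum H (A := ⟨U⟩) (B := ⟨Uᗮ⟩) U.orthogonalDecomposition, hU⟩
  exists_splitting_mult {X} ρ O := by
    obtain ⟨U, hU, hU'⟩ := UnitaryRep.exists_splitting_component ρ O
    exact ⟨⟨U⟩, ⟨Uᗮ⟩, HilbertSum.sumHom U.orthogonalDecomposition,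
      isSplitting_hilbertSum H (A := ⟨U⟩) (B := ⟨Uᗮ⟩) U.orthogonalDecomposition, hU, hU'⟩
  exists_transport {X Y} h := by
    let e : X.carrier ≃ₗᵢ[ℂ] Y.carrier := (stdOrthonormalBasis ℂ X.carrier).equiv
      (stdOrthonormalBasis ℂ Y.carrier) (finCongr h)
    let f : X.Aut →* Y.Aut :=
      { toFun a := (e.symm.trans a).trans e
        map_one' := by ext; simp
        map_mul' a b := by ext; simp }
    exact ⟨f, fun ρ τ => (UnitaryRep.mult_congr e (fun h v => by simp [f]) τ).symm⟩
  exists_conj ρ ρ' := UnitaryRep.exists_conj_of_mult_eq ρ ρ'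

theorem hsDist_eq_sqrt (H : Type*) [Group H] [Fintype H] [Fintype (UnitaryRep.CharType H)]
    (X : FdHilb) (a b : X.Aut) : hsDist X a b = √((unitarySystem H).dist X a b) := rfl

theorem isHSStable_iff (H : Type*) [Group H] [Fintype H] [Fintype (UnitaryRep.CharType H)]
    (G : Type*) [Group G] : IsHSStable G ↔ IsStableWrt FdHilb.Aut (unitarySystem H).dist G := by
  have key : ∀ (X : ℕ → FdHilb) (a b : ∀ n, (X n).Aut),
      Tendsto (fun n => hsDist (X n) (a n) (b n)) atTop (𝓝 0) ↔
        Tendsto (fun n => (unitarySystem H).dist (X n) (a n) (b n)) atTop (𝓝 0) := by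
    intro X a b
    simp only [hsDist_eq_sqrt H]
    refine ⟨fun h => ?_, fun h => by simpa using h.sqrt⟩
    have hsq : ∀ n, √((unitarySystem H).dist (X n) (a n) (b n)) ^ 2 =
        (unitarySystem H).dist (X n) (a n) (b n) := fun n =>
      Real.sq_sqrt (div_nonneg ((unitarySystem H).gap_nonneg _ _) (Nat.cast_nonneg _))
    simpa [hsq] using h.pow 2
  simp only [IsHSStable, IsStableWrt, key]

theorem IsHSStable.amalgamatedProduct
    {H G₁ G₂ : Type*} [Group H] [Group G₁] [Group G₂] [Finite H]
    {i₁ : H →* G₁} {i₂ : H →* G₂} (hi₁ : Function.Injective i₁) (hi₂ : Function.Injective i₂)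
    (hn₁ : i₁.range.Normal) (hn₂ : i₂.range.Normal)
    (hG₁ : IsHSStable G₁) (hG₂ : IsHSStable G₂) :
    IsHSStable (AmalgamatedProduct i₁ i₂) := by
  have := Fintype.ofFinite H
  have := Fintype.ofFinite (UnitaryRep.CharType H)
  obtain ⟨θ₁, hθ₁⟩ := exists_conj_action i₁ hi₁ hn₁
  obtain ⟨θ₂, hθ₂⟩ := exists_conj_action i₂ hi₂ hn₂
  rw [isHSStable_iff H] at *
  exact (unitarySystem H).isStableWrt_amalgamatedProduct hθ₁ hθ₂ hG₁ hG₂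

open scoped Pointwise in
theorem IsPStable.amalgamatedProduct
    {H G₁ G₂ : Type*} [Group H] [Group G₁] [Group G₂] [Finite H]
    {i₁ : H →* G₁} {i₂ : H →* G₂} (hi₁ : Function.Injective i₁) (hi₂ : Function.Injective i₂)
    (hn₁ : i₁.range.Normal) (hn₂ : i₂.range.Normal)
    (hG₁ : IsPStable G₁) (hG₂ : IsPStable G₂) :
    IsPStable (AmalgamatedProduct i₁ i₂) := by
  have := Fintype.ofFinite H
  have := Fintype.ofFinite (Subgroup H)
  obtain ⟨θ₁, hθ₁⟩ := exists_conj_action i₁ hi₁ hn₁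
  obtain ⟨θ₂, hθ₂⟩ := exists_conj_action i₂ hi₂ hn₂
  exact (permSystem H).isStableWrt_amalgamatedProduct hθ₁ hθ₂ hG₁ hG₂

theorem mainTheorem8 {H G₁ G₂ : Type*} [Group H] [Group G₁] [Group G₂]
    [Finite H] [Group.FG G₁] [Group.FG G₂]
    (i₁ : H →* G₁) (i₂ : H →* G₂)
    (hi₁ : Function.Injective i₁) (hi₂ : Function.Injective i₂)
    (hn₁ : i₁.range.Normal) (hn₂ : i₂.range.Normal) :
    (IsHSStable G₁ → IsHSStable G₂ → IsHSStable (AmalgamatedProduct i₁ i₂)) ∧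
    (IsPStable G₁ → IsPStable G₂ → IsPStable (AmalgamatedProduct i₁ i₂)) := by
  exact ⟨IsHSStable.amalgamatedProduct hi₁ hi₂ hn₁ hn₂,
    IsPStable.amalgamatedProduct hi₁ hi₂ hn₁ hn₂⟩

end
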